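/- Let $p \ge 5$ be a prime, let $\overline{\mathbf F}_p$ be an algebraic closure of $\mathbf F_p$, and let $\theta \in \overline{\mathbf F}_p \setminus \{0,-1\}$, where moreover $\theta \neq 2$ if $p = 5$. For $r, s \in \mathbf F_p^* = \mathbf F_p\setminus\{0\}$ put $$M_\theta(r,s) = \begin{pmatrix} 1 & 0 \\ -r\theta & 1\end{pmatrix}\begin{pmatrix} 1 & -r^{-1} \\ 0 & 1\end{pmatrix}\begin{pmatrix} 1 & s^{-1} \\ 0 & 1\end{pmatrix}\begin{pmatrix} 1 & 0 \\ s\theta & 1\end{pmatrix}.$$ Then the matrices $M_\theta(r,s)$, as $r,s$ range over $\mathbf F_p^*$, generate the group $\mathrm{SL}_2(\mathbf F_p(\theta))$. -/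

import Mathlib

/-- The lower unipotent matrix `(1, 0; x, 1)` in `SL₂(K)`. -/
def lowerUnipotent {K : Type*} [Field K] (x : K) : Matrix.SpecialLinearGroup (Fin 2) K :=
  ⟨!![1, 0; x, 1], by simp [Matrix.det_fin_two_of]⟩

/-- The upper unipotent matrix `(1, x; 0, 1)` in `SL₂(K)`. -/
def upperUnipotent {K : Type*} [Field K] (x : K) : Matrix.SpecialLinearGroup (Fin 2) K :=
  ⟨!![1, x; 0, 1], by simp [Matrix.det_fin_two_of]⟩

/-- The matrix
`M_θ(r,s) = (1, 0; -rθ, 1) (1, -r⁻¹; 0, 1) (1, s⁻¹; 0, 1) (1, 0; sθ, 1)` in `SL₂(K)`,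
for `θ` in an extension `K` of `F` and `r, s` in the multiplicative group of `F`. -/
def scalarGenerator {F K : Type*} [Field F] [Field K] [Algebra F K] (θ : K) (r s : Fˣ) :
    Matrix.SpecialLinearGroup (Fin 2) K :=
  lowerUnipotent (-(algebraMap F K (r : F) * θ)) *
    upperUnipotent (-(algebraMap F K (r : F))⁻¹) *
    upperUnipotent ((algebraMap F K (s : F))⁻¹) *
    lowerUnipotent (algebraMap F K (s : F) * θ)

open MulAction

/-! Let G be the group generated by the M_θ(r,s). Since M_θ(r,s) = h(r)⁻¹h(s) with `halfGenerator`
h, and conjugation by diag(u,1) turns M_θ(r,s) into M_θ(r/u,s/u), the torus D = {diag(u,1) : u ∈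
F_p^*} normalises G. The finite group Γ = GD (`torusExtension`) contains D and also C = h(1)⁻¹Dh(1).
On the projective line over the algebraic closure, D fixes ∞ and 0, while C fixes -1/θ and -1/(1+θ).
These pairs are disjoint because θ ≠ 0, -1.

Let H be the image of Γ in PGL₂. A nontrivial element of H fixes two points, or one point if it is
parabolic. Counting fixed points, with those of parabolic elements counted twice, gives an orbit
equation as in the classification of finite rotation groups. Without parabolic elements, the
stabilizers of order divisible by p-1 ≥ 4 leave only the octahedral case with p = 5, and the
position of the four fixed points then forces θ = 2 (`exists_parabolic_torusExtension`).

So H has a parabolic element, and its fixed point P is moved, as C and D have no common fixed point.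
The orbit equation, with a divisibility argument, shows that the parabolic elements fixing P permute
the rest of the orbit of P transitively (`IsMoebiusLike.exists_parabolic_smul_eq`). After a change
of coordinate the orbit is the projective line over a finite set closed under addition and harmonic
sums, which is a subfield A by an identity of Hua (`exists_subfield_of_parabolic`).

Traces of elements of C, D and CD give θ ∈ A (`mem_subfield_of_preserves`). Hence a conjugate of Γ
contains all elementary matrices over F_p(θ) up to scalars. Suitable powers remove the scalars, and
comparing cardinalities gives G = SL₂(F_p(θ)) (`scalarGroup_eq_top_of_subfield`). -/

/-- The properties of Möbius transformation groups in characteristic `p` on a projective line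
over an algebraically closed field that are used in the orbit count. -/
structure IsMoebiusLike (p : ℕ) (H X : Type*) [Group H] [MulAction H X] : Prop where
  exists_fixed : ∀ h : H, ∃ x : X, h • x = x
  eq_one_of_three : ∀ (h : H) (x y z : X), x ≠ y → x ≠ z → y ≠ z →
    h • x = x → h • y = y → h • z = z → h = 1
  commute_of_parabolic : ∀ (h k : H) (x : X), fixedBy X h = {x} → fixedBy X k = {x} → h * k = k * h
  pow_eq_one : ∀ (h : H) (x : X), fixedBy X h = {x} → h ^ p = 1

/-! ### Counting fixed points orbit by orbit. -/

section OrbitCount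

variable {p : ℕ} {H X : Type*} [Group H] [MulAction H X]

/-- The number of elements of `H` which are trivial or fix the point `x` only. -/
noncomputable def parabolicCount (H : Type*) {X : Type*} [Group H] [MulAction H X] (x : X) : ℕ :=
  Nat.card {h : H // h = 1 ∨ fixedBy X h = {x}}

open scoped Pointwise in
lemma parabolicCount_smul (h : H) (x : X) : parabolicCount H (h • x) = parabolicCount H x := by
  symm
  refine Nat.card_congr ((MulAut.conj h).toEquiv.subtypeEquiv fun k => ?_)
  have h1 : fixedBy X (h * k * h⁻¹) = {h • x} ↔ fixedBy X k = {x} := by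
    rw [← smul_fixedBy, ← Set.smul_set_singleton, (MulAction.injective h).eq_iff]
  simp only [MulEquiv.toEquiv_eq_coe, MulEquiv.coe_toEquiv, MulAut.conj_apply, h1,
    conj_eq_one_iff]

lemma card_stabilizer_smul (h : H) (x : X) :
    Nat.card (stabilizer H (h • x)) = Nat.card (stabilizer H x) :=
  (Nat.card_congr (stabilizerEquivStabilizer (g := h) rfl).toEquiv).symm

lemma parabolicCount_pos [Finite H] (x : X) : 1 ≤ parabolicCount H x :=
  Nat.card_pos_iff.2 ⟨⟨⟨1, Or.inl rfl⟩⟩, inferInstance⟩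

lemma exists_parabolic_of_one_lt {x : X} (hx : 1 < parabolicCount H x) :
    ∃ h : H, h ≠ 1 ∧ fixedBy X h = {x} := by
  by_contra! hc
  have : Subsingleton {h : H // h = 1 ∨ fixedBy X h = {x}} := by
    constructor
    rintro ⟨a, ha⟩ ⟨b, hb⟩
    have ha' : a = 1 := ha.elim id fun h => by_contra fun h1 => hc a h1 h
    have hb' : b = 1 := hb.elim id fun h => by_contra fun h1 => hc b h1 h
    simp [ha', hb']
  have := Finite.card_le_one_iff_subsingleton.2 this
  unfold parabolicCount at hx
  omega

/-- The points fixed by some nontrivial group element. -/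
def poles (H X : Type*) [Group H] [MulAction H X] : Set X := {x | ∃ h : H, h ≠ 1 ∧ h • x = x}

lemma smul_mem_poles (h : H) {x : X} (hx : x ∈ poles H X) : h • x ∈ poles H X := by
  obtain ⟨k, hk, hkx⟩ := hx
  exact ⟨h * k * h⁻¹, by simpa using hk, by simp [mul_smul, hkx]⟩

lemma two_le_card_stabilizer [Finite H] {x : X} (hx : x ∈ poles H X) :
    2 ≤ Nat.card (stabilizer H x) := by
  obtain ⟨k, hk, hkx⟩ := hx
  have : Nontrivial (stabilizer H x) := ⟨⟨⟨k, hkx⟩, 1, fun h => hk (congrArg Subtype.val h)⟩⟩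
  exact Finite.one_lt_card

namespace IsMoebiusLike

variable (hM : IsMoebiusLike p H X)
include hM

lemma fixedBy_cases {h : H} (hh : h ≠ 1) :
    (∃ x, fixedBy X h = {x}) ∨ ∃ x y, x ≠ y ∧ fixedBy X h = {x, y} := by
  obtain ⟨x, hx⟩ := hM.exists_fixed h
  by_cases hy : ∃ y, y ≠ x ∧ h • y = y
  · obtain ⟨y, hyx, hy⟩ := hy
    refine Or.inr ⟨x, y, hyx.symm, ?_⟩
    ext z
    simp only [mem_fixedBy, Set.mem_insert_iff, Set.mem_singleton_iff]
    constructor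
    · intro hz
      by_contra! hc
      exact hh (hM.eq_one_of_three h x y z hyx.symm hc.1.symm hc.2.symm hx hy hz)
    · rintro (rfl | rfl) <;> assumption
  · push Not at hy
    refine Or.inl ⟨x, ?_⟩
    ext z
    simp only [mem_fixedBy, Set.mem_singleton_iff]
    exact ⟨fun hz => by_contra fun hc => hy z hc hz, fun hz => hz ▸ hx⟩

lemma finite_fixedBy {h : H} (hh : h ≠ 1) : (fixedBy X h).Finite := by
  rcases hM.fixedBy_cases hh with ⟨x, hx⟩ | ⟨x, y, -, hx⟩ <;> rw [hx] <;> simp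

lemma finite_poles [Finite H] : (poles H X).Finite := by
  have : poles H X ⊆ ⋃ h : {h : H // h ≠ 1}, fixedBy X h.1 := by
    rintro x ⟨h, hh, hx⟩
    exact Set.mem_iUnion.2 ⟨⟨h, hh⟩, hx⟩
  exact (Set.finite_iUnion fun h => hM.finite_fixedBy h.2).subset this

omit hM in
/-- The contribution of a point to the count of fixed points. -/
noncomputable def _root_.poleWeight (H : Type*) {X : Type*} [Group H] [MulAction H X] (x : X) : ℤ :=
  Nat.card (stabilizer H x) + parabolicCount H x - 2

open scoped Classical in
omit hM in
lemma _root_.poleWeight_eq [Fintype H] (x : X) : poleWeight H x =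
    ∑ h ∈ Finset.univ.erase (1 : H), ((if h • x = x then 1 else 0) +
      (if fixedBy X h = {x} then 1 else 0) : ℤ) := by
  have h1 : (Nat.card (stabilizer H x) : ℤ) = ∑ h : H, if h • x = x then 1 else 0 := by
    rw [Finset.sum_boole, Nat.card_eq_fintype_card]
    congr 1
    exact Fintype.card_subtype _
  have h2 : (parabolicCount H x : ℤ) = ∑ h : H, if h = 1 ∨ fixedBy X h = {x} then 1 else 0 := by
    rw [Finset.sum_boole, parabolicCount, Nat.card_eq_fintype_card]
    congr 1
    exact Fintype.card_subtype _
  rw [poleWeight, h1, h2, ← Finset.add_sum_erase _ _ (Finset.mem_univ (1 : H)),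
    ← Finset.add_sum_erase (a := (1 : H)) _ (fun h => if h = 1 ∨ fixedBy X h = {x} then (1 : ℤ) else 0)
      (Finset.mem_univ (1 : H)), Finset.sum_add_distrib]
  have h3 : ∑ h ∈ Finset.univ.erase (1 : H), (if h = 1 ∨ fixedBy X h = {x} then (1 : ℤ) else 0) =
      ∑ h ∈ Finset.univ.erase (1 : H), (if fixedBy X h = {x} then (1 : ℤ) else 0) :=
    Finset.sum_congr rfl fun h hh => by simp [(Finset.mem_erase.1 hh).1]
  rw [h3]
  simp
  ring

/-- Each nontrivial element contributes 2: either through two fixed points, or through one point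
where it is counted both in the stabilizer and as parabolic. The -2 in `poleWeight` removes the
identity from both counts. -/
lemma sum_poleWeight [Finite H] :
    ∑ x ∈ hM.finite_poles.toFinset, poleWeight H x = 2 * ((Nat.card H : ℤ) - 1) := by
  classical
  have := Fintype.ofFinite H
  simp_rw [poleWeight_eq]
  rw [Finset.sum_comm]
  have : ∀ h ∈ Finset.univ.erase (1 : H), ∑ x ∈ hM.finite_poles.toFinset,
      ((if h • x = x then 1 else 0) + (if fixedBy X h = {x} then 1 else 0) : ℤ) = 2 := by
    intro h hh
    have hh1 := (Finset.mem_erase.1 hh).1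
    rw [Finset.sum_add_distrib, Finset.sum_boole, Finset.sum_boole]
    rcases hM.fixedBy_cases hh1 with ⟨x, hx⟩ | ⟨x, y, hxy, hx⟩
    · have hfix : ∀ z, h • z = z ↔ z = x := fun z => by
        rw [← mem_fixedBy, hx, Set.mem_singleton_iff]
      have h1 : hM.finite_poles.toFinset.filter (fun z => h • z = z) = {x} := by
        ext z
        simp only [Finset.mem_filter, Set.Finite.mem_toFinset, Finset.mem_singleton, hfix]
        exact ⟨fun h => h.2, fun hz => ⟨⟨h, hh1, (hfix z).2 hz⟩, hz⟩⟩
      have h2 : hM.finite_poles.toFinset.filter (fun z => fixedBy X h = {z}) = {x} := by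
        ext z
        simp only [Finset.mem_filter, Set.Finite.mem_toFinset, Finset.mem_singleton, hx,
          Set.singleton_eq_singleton_iff]
        exact ⟨fun h => h.2.symm, fun hz => ⟨⟨h, hh1, (hfix z).2 hz⟩, hz.symm⟩⟩
      rw [h1, h2]; simp
    · have hfix : ∀ z, h • z = z ↔ z = x ∨ z = y := fun z => by
        rw [← mem_fixedBy, hx, Set.mem_insert_iff, Set.mem_singleton_iff]
      have h1 : hM.finite_poles.toFinset.filter (fun z => h • z = z) = {x, y} := by
        ext z
        simp only [Finset.mem_filter, Set.Finite.mem_toFinset, Finset.mem_singleton,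
          Finset.mem_insert, hfix]
        exact ⟨fun h => h.2, fun hz => ⟨⟨h, hh1, (hfix z).2 hz⟩, hz⟩⟩
      have h2 : hM.finite_poles.toFinset.filter (fun z => fixedBy X h = {z}) = ∅ := by
        ext z
        simp only [Finset.mem_filter, Finset.notMem_empty, iff_false, not_and, hx]
        intro _ hz
        have h1 : x = z := by
          have : x ∈ ({z} : Set X) := hz ▸ by simp
          exact this
        have h2 : y = z := by
          have : y ∈ ({z} : Set X) := hz ▸ by simp
          exact this
        exact hxy (h1.trans h2.symm)
      rw [h1, h2, Finset.card_pair hxy]; simp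
  rw [Finset.sum_congr rfl this, Finset.sum_const, Finset.card_erase_of_mem (Finset.mem_univ _),
    Finset.card_univ, Nat.card_eq_fintype_card, nsmul_eq_mul,
    Nat.cast_sub Fintype.card_pos]
  push_cast
  ring

end IsMoebiusLike

lemma card_orbit_mul_card_stabilizer [Finite H] (x : X) :
    Nat.card (orbit H x) * Nat.card (stabilizer H x) = Nat.card H := by
  rw [← Nat.card_prod, Nat.card_congr (orbitProdStabilizerEquivGroup H x)]

open scoped Classical in
/-- Splitting off one orbit from a sum of weights over an invariant set of points. -/
lemma sum_poleWeight_peel [Finite H] (S : Finset X) (hS : ∀ (h : H), ∀ x ∈ S, h • x ∈ S) {x : X}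
    (hx : x ∈ S) : ∃ T ⊆ S, (∀ (h : H), ∀ x ∈ T, h • x ∈ T) ∧ (∀ y, y ∈ S ↔ y ∈ T ∨ y ∈ orbit H x) ∧
      (∀ y ∈ T, y ∉ orbit H x) ∧
      ∑ y ∈ S, poleWeight H y =
        ∑ y ∈ T, poleWeight H y + (Nat.card H + Nat.card (orbit H x) * ((parabolicCount H x : ℤ) - 2)) := by
  have hfin : (orbit H x).Finite := Set.finite_range _
  have hsub : hfin.toFinset ⊆ S := by
    intro y hy
    obtain ⟨h, rfl⟩ := (Set.Finite.mem_toFinset _).1 hy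
    exact hS h x hx
  refine ⟨S \ hfin.toFinset, Finset.sdiff_subset, ?_, ?_, ?_, ?_⟩
  · intro h y hy
    simp only [Finset.mem_sdiff, Set.Finite.mem_toFinset] at hy ⊢
    refine ⟨hS h y hy.1, fun hc => hy.2 ?_⟩
    rwa [← orbit_eq_iff, orbit_smul, orbit_eq_iff] at hc
  · intro y
    simp only [Finset.mem_sdiff, Set.Finite.mem_toFinset]
    have : y ∈ orbit H x → y ∈ S := fun h => hsub (by simpa using h)
    tauto
  · simp
  · rw [← Finset.sum_sdiff hsub]
    congr 1
    have : ∀ y ∈ hfin.toFinset, poleWeight H y = poleWeight H x := by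
      intro y hy
      obtain ⟨h, rfl⟩ := (Set.Finite.mem_toFinset _).1 hy
      simp only [poleWeight, card_stabilizer_smul, parabolicCount_smul]
    -- An orbit of n points with stabilizers of order e and parabolic count q contributes n(e + q -
    -- 2), where ne = |H|.
    rw [Finset.sum_congr rfl this, Finset.sum_const, nsmul_eq_mul,
      ← Nat.card_eq_card_finite_toFinset, ← card_orbit_mul_card_stabilizer (H := H) x, poleWeight]
    push_cast
    ring

end OrbitCount

/-! ### Solving the orbit equation, with and without parabolic elements. -/

section OrbitCountConsequences

variable {p : ℕ} {H X : Type*} [Group H] [MulAction H X]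

lemma sum_poleWeight_nonneg [Finite H] {T : Finset X} (hT : ∀ y ∈ T, y ∈ poles H X) :
    0 ≤ ∑ y ∈ T, poleWeight H y := by
  refine Finset.sum_nonneg fun y hy => ?_
  have h1 := two_le_card_stabilizer (hT y hy)
  have h2 := parabolicCount_pos (H := H) y
  unfold poleWeight
  omega

lemma two_mul_card_orbit_le [Finite H] {x : X} (hx : x ∈ poles H X) :
    2 * Nat.card (orbit H x) ≤ Nat.card H := by
  rw [← card_orbit_mul_card_stabilizer (H := H) x, mul_comm]
  exact Nat.mul_le_mul_left _ (two_le_card_stabilizer hx)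

lemma card_orbit_pos [Finite H] (x : X) : 0 < Nat.card (orbit H x) := by
  have : Finite (orbit H x) := Set.finite_range _
  exact Nat.card_pos_iff.2 ⟨⟨⟨x, mem_orbit_self x⟩⟩, inferInstance⟩

namespace IsMoebiusLike

variable (hM : IsMoebiusLike p H X)
include hM

/-- An element k commuting with u preserves the unique fixed point x of u. If k fixed some y ≠ x, it
would also fix u • y, a third point, so k = 1. -/
lemma mem_centralizer_iff {u : H} {x : X} (hux : fixedBy X u = {x}) (k : H) :
    k ∈ Subgroup.centralizer {u} ↔ k = 1 ∨ fixedBy X k = {x} := by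
  have hfix : ∀ z, u • z = z ↔ z = x := fun z => by
    rw [← mem_fixedBy, hux, Set.mem_singleton_iff]
  rw [Subgroup.mem_centralizer_singleton_iff]
  constructor
  · intro hk
    have hkx : k • x = x := by
      rw [← hfix, ← mul_smul, ← hk, mul_smul, (hfix x).2 rfl]
    refine or_iff_not_imp_left.2 fun hk1 => Set.eq_singleton_iff_unique_mem.2 ⟨hkx, fun y hy => ?_⟩
    by_contra hyx
    refine hk1 (hM.eq_one_of_three k x y (u • y) (Ne.symm hyx) ?_ ?_ hkx hy ?_)
    · intro h
      exact hyx (MulAction.injective u (h.symm.trans ((hfix x).2 rfl).symm))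
    · exact fun h => hyx ((hfix y).1 h.symm)
    · rw [← mul_smul, hk, mul_smul]
      congr 1
  · rintro (rfl | hk)
    · simp
    · exact hM.commute_of_parabolic k u x hk hux

lemma card_centralizer {u : H} {x : X} (hux : fixedBy X u = {x}) :
    Nat.card (Subgroup.centralizer {u}) = parabolicCount H x :=
  Nat.card_congr (Equiv.subtypeEquivRight fun k => hM.mem_centralizer_iff hux k)

lemma le_parabolicCount [Finite H] [hp : Fact p.Prime] {x : X} (hx : 1 < parabolicCount H x) :
    p ≤ parabolicCount H x := by
  obtain ⟨u, hu1, hux⟩ := exists_parabolic_of_one_lt hx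
  have h1 : orderOf u = p := orderOf_eq_prime (hM.pow_eq_one u x hux) hu1
  rw [← hM.card_centralizer hux, ← h1, ← Nat.card_zpowers]
  refine Subgroup.card_le_of_le (Subgroup.zpowers_le.2 ?_)
  simp [Subgroup.mem_centralizer_singleton_iff]

-- The stabilizer of x acts by conjugation on the q - 1 nontrivial parabolic elements at x. The
-- fibres of s ↦ s u s⁻¹ have at most q elements, the order of the centralizer of u, so the
-- stabilizer has order at most q(q - 1).
open scoped Pointwise in
lemma card_stabilizer_eq_mul [Finite H] {x : X} (hx : 1 < parabolicCount H x) :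
    ∃ c, 1 ≤ c ∧ c + 1 ≤ parabolicCount H x ∧
      Nat.card (stabilizer H x) = parabolicCount H x * c := by
  classical
  obtain ⟨u, hu1, hux⟩ := exists_parabolic_of_one_lt hx
  have hle : Subgroup.centralizer {u} ≤ stabilizer H x := by
    intro k hk
    rcases (hM.mem_centralizer_iff hux k).1 hk with rfl | hk
    · simp
    · have : x ∈ fixedBy X k := hk ▸ rfl
      exact this
  obtain ⟨c, hc⟩ := Subgroup.card_dvd_of_le hle
  rw [hM.card_centralizer hux] at hc
  have hcpos : 0 < Nat.card (stabilizer H x) := Nat.card_pos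
  refine ⟨c, ?_, ?_, hc⟩
  · rcases Nat.eq_zero_or_pos c with rfl | h
    · omega
    · exact h
  have := Fintype.ofFinite H
  have key : Nat.card (stabilizer H x) ≤ parabolicCount H x * (parabolicCount H x - 1) := by
    have h1 : Nat.card (stabilizer H x) = (Finset.univ.filter fun h : H => h • x = x).card := by
      rw [Nat.card_eq_fintype_card]
      exact Fintype.card_subtype _
    have h2 : parabolicCount H x =
        (Finset.univ.filter fun h : H => h = 1 ∨ fixedBy X h = {x}).card := by
      rw [parabolicCount, Nat.card_eq_fintype_card]
      exact Fintype.card_subtype _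
    have h3 : parabolicCount H x - 1 =
        ((Finset.univ.filter fun h : H => h = 1 ∨ fixedBy X h = {x}).erase 1).card := by
      rw [Finset.card_erase_of_mem (by simp), h2]
    rw [h1, h3]
    refine Finset.card_le_mul_card_image_of_maps_to (f := fun s => s * u * s⁻¹) ?_ _ ?_
    · intro s hs
      have hs : s • x = x := by simpa using hs
      have : fixedBy X (s * u * s⁻¹) = {x} := by
        rw [← smul_fixedBy, hux, Set.smul_set_singleton, hs]
      simp [this, hu1]
    · intro b _
      rcases (Finset.filter (fun s => s * u * s⁻¹ = b)
        (Finset.univ.filter fun h : H => h • x = x)).eq_empty_or_nonempty with h0 | ⟨s0, hs0⟩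
      · rw [h0]; simp
      · rw [h2]
        refine Finset.card_le_card_of_injOn (fun s => s0⁻¹ * s) ?_ ?_
        · intro s hs
          simp only [Finset.coe_filter, Finset.mem_filter, Finset.mem_univ, true_and,
            Set.mem_ofPred_eq] at hs hs0 ⊢
          rw [← hM.mem_centralizer_iff hux, Subgroup.mem_centralizer_singleton_iff]
          have h4 := hs.2.trans hs0.2.symm
          have h5 : s * u = s0 * u * s0⁻¹ * s := by rw [← h4]; group
          rw [mul_assoc, h5]; group
        · intro a _ b _ hab
          exact mul_left_cancel hab
  rw [hc] at key
  have := Nat.le_of_mul_le_mul_left key (by omega)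
  omega

-- The equation shows that 1 + k(q - 2) divides 2kc. Being prime to k it divides 2c ≤ 2(q - 1),
-- which leaves k ≤ 2. For k = 2 it is odd, hence divides c, and is too large.
omit hM in
lemma _root_.eq_one_of_orbit_equation {q c k e : ℕ} (hq : 5 ≤ q) (hc : 1 ≤ c) (hcq : c + 1 ≤ q)
    (hk : 1 ≤ k) (h : e * (1 + k * (q - 2)) = c * (1 + k * q)) : k = 1 := by
  obtain ⟨r, rfl⟩ : ∃ r, q = r + 2 := ⟨q - 2, by omega⟩
  rw [Nat.add_sub_cancel] at h
  have h1 : 1 + k * r ∣ k * (2 * c) := by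
    have h2 : 1 + k * r ∣ c * (1 + k * r) + k * (2 * c) := ⟨e, by linarith⟩
    exact (Nat.dvd_add_right (Dvd.intro_left _ rfl)).1 h2
  have hcop : Nat.Coprime (1 + k * r) k := by simp
  have h3 : 1 + k * r ∣ 2 * c := hcop.dvd_of_dvd_mul_left h1
  have h4 := Nat.le_of_dvd (by omega) h3
  have h5 : k ≤ 2 := by
    by_contra! h6
    have : 3 * r ≤ k * r := Nat.mul_le_mul_right _ h6
    omega
  interval_cases k
  · rfl
  · exfalso
    have hodd : Nat.Coprime (1 + 2 * r) 2 := by simp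
    have h6 := Nat.le_of_dvd (by omega) (hodd.dvd_of_dvd_mul_left h3)
    omega

/-- The orbit equation in the presence of parabolic elements: there is exactly one other orbit
of poles. -/
lemma exists_other_orbit [Finite H] {x : X} (hq : 5 ≤ parabolicCount H x)
    (hn : 2 ≤ Nat.card (orbit H x)) :
    ∃ e, (2 + Nat.card (orbit H x) * (parabolicCount H x - 2)) * e = Nat.card H := by
  classical
  obtain ⟨c, hc1, hcq, hec⟩ := hM.card_stabilizer_eq_mul (x := x) (by omega)
  obtain ⟨u, hu1, hux⟩ := exists_parabolic_of_one_lt (H := H) (x := x) (by omega)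
  have hxu : u • x = x := by
    have : x ∈ fixedBy X u := hux ▸ rfl
    exact this
  have hg := card_orbit_mul_card_stabilizer (H := H) x
  rw [hec] at hg
  have hsum := hM.sum_poleWeight
  obtain ⟨T1, hT1, hT1i, -, -, h1⟩ := sum_poleWeight_peel hM.finite_poles.toFinset
    (fun h x hx => by simpa using smul_mem_poles h (by simpa using hx)) (x := x)
    (by simpa using ⟨u, hu1, hxu⟩)
  have hT1p : ∀ y ∈ T1, y ∈ poles H X := fun y hy => by simpa using hT1 hy
  obtain ⟨r, hr⟩ : ∃ r, parabolicCount H x = r + 2 := ⟨parabolicCount H x - 2, by omega⟩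
  rw [hr, Nat.add_sub_cancel]
  rw [hr] at hg h1 hq
  set n := Nat.card (orbit H x)
  set g := Nat.card H
  have hnr : 0 ≤ (n : ℤ) * r := by positivity
  push_cast at h1
  rw [h1, add_sub_cancel_right] at hsum
  -- With a single orbit the equation reads n((r + 2)c - r) = 2, but both factors are at least 2.
  rcases T1.eq_empty_or_nonempty with rfl | ⟨x2, hx2⟩
  · exfalso
    rw [Finset.sum_empty, zero_add] at hsum
    have hg' : (n : ℤ) * ((r + 2) * c) = g := by exact_mod_cast hg
    have hn' : (2 : ℤ) ≤ n := by exact_mod_cast hn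
    have hc' : (1 : ℤ) ≤ c := by exact_mod_cast hc1
    have h5 : (n : ℤ) * ((r + 2) * c - r) = 2 := by rw [mul_sub, hg']; linarith
    have h6 : (2 : ℤ) ≤ (r + 2) * c - r := by nlinarith
    nlinarith
  obtain ⟨T2, hT2, hT2i, -, -, h2⟩ := sum_poleWeight_peel T1 hT1i hx2
  have hT2p : ∀ y ∈ T2, y ∈ poles H X := fun y hy => hT1p y (hT2 hy)
  have hs2 := sum_poleWeight_nonneg hT2p
  have hle2 := two_mul_card_orbit_le (hT1p x2 hx2)
  have hg2 := card_orbit_mul_card_stabilizer (H := H) x2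
  set n2 := Nat.card (orbit H x2)
  -- A second orbit with parabolic elements would contribute at least |H|, making the total exceed
  -- 2(|H| - 1).
  have hq2 : parabolicCount H x2 = 1 := by
    by_contra hne
    have h3 := parabolicCount_pos (H := H) x2
    have h4 : (0 : ℤ) ≤ parabolicCount H x2 - 2 := by omega
    have h5 : 0 ≤ (n2 : ℤ) * (parabolicCount H x2 - 2) := by positivity
    linarith
  rw [hq2] at h2
  push_cast at h2
  -- Two orbits give n₂ = 2 + n(q - 2), a divisor of |H|. With a third, the second and third would
  -- each contribute at least |H|/2, which is too much.
  rcases T2.eq_empty_or_nonempty with rfl | ⟨x3, hx3⟩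
  · refine ⟨Nat.card (stabilizer H x2), ?_⟩
    rw [Finset.sum_empty, zero_add] at h2
    change _ = Nat.card H
    rw [← hg2]
    congr 1
    zify
    linarith
  · exfalso
    obtain ⟨T3, hT3, -, -, -, h3⟩ := sum_poleWeight_peel T2 hT2i hx3
    have hs3 := sum_poleWeight_nonneg (fun y hy => hT2p y (hT3 hy))
    have hle3 := two_mul_card_orbit_le (hT2p x3 hx3)
    have hq3 := parabolicCount_pos (H := H) x3
    set n3 := Nat.card (orbit H x3)
    have h6 : (n3 : ℤ) * (-1) ≤ (n3 : ℤ) * (parabolicCount H x3 - 2) :=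
      mul_le_mul_of_nonneg_left (by omega) (by positivity)
    zify at hle2 hle3
    linarith

/-- The group of parabolic elements with fixed point `x` acts transitively on the rest of the
orbit of `x`. -/
theorem exists_parabolic_smul_eq [Finite H] [Fact p.Prime] (hp : 5 ≤ p) {x : X}
    (hq : 1 < parabolicCount H x) (hn : 2 ≤ Nat.card (orbit H x)) :
    Nat.card (orbit H x) = parabolicCount H x + 1 ∧
    ∀ y ∈ orbit H x, ∀ z ∈ orbit H x, y ≠ x → z ≠ x →
      ∃ h : H, h • y = z ∧ (h = 1 ∨ fixedBy X h = {x}) := by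
  have hq5 : 5 ≤ parabolicCount H x := hp.trans (hM.le_parabolicCount hq)
  obtain ⟨u, hu1, hux⟩ := exists_parabolic_of_one_lt hq
  obtain ⟨c, hc1, hcq, hec⟩ := hM.card_stabilizer_eq_mul hq
  obtain ⟨e, he⟩ := hM.exists_other_orbit hq5 hn
  have hg := card_orbit_mul_card_stabilizer (H := H) x
  have hfin : Finite (orbit H x) := Set.finite_range _
  let C := Subgroup.centralizer {u}
  have hCx : ∀ k : C, k • x = x := by
    rintro ⟨k, hk⟩
    rcases (hM.mem_centralizer_iff hux k).1 hk with rfl | hk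
    · simp
    · have : x ∈ fixedBy X k := hk ▸ rfl
      exact this
  -- The centralizer C of u acts freely on the orbit with x removed, so n = 1 + kq with k the number
  -- of C-orbits. Transitivity means k = 1.
  let T : SubMulAction C X :=
    { carrier := orbit H x \ {x}
      smul_mem' := by
        rintro k y ⟨hy, hyx⟩
        refine ⟨?_, fun h => hyx ?_⟩
        · rw [Subgroup.smul_def, ← orbit_eq_iff, orbit_smul, orbit_eq_iff]; exact hy
        · exact MulAction.injective k (Eq.trans h (hCx k).symm) }
  have hT : ∀ y, y ∈ T ↔ y ∈ orbit H x ∧ y ≠ x := fun y => Iff.rfl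
  have hfree : ∀ b : T, stabilizer C b = ⊥ := by
    rintro ⟨b, hb⟩
    rw [eq_bot_iff]
    rintro ⟨k, hk⟩ hkb
    have hkb' : k • b = b := congrArg Subtype.val hkb
    rcases (hM.mem_centralizer_iff hux k).1 hk with rfl | hk
    · exact Subgroup.mem_bot.2 rfl
    · have : b ∈ ({x} : Set X) := hk ▸ hkb'
      exact absurd this ((hT b).1 hb).2
  have hcard := Nat.card_congr (selfEquivOrbitsQuotientProd hfree)
  rw [Nat.card_prod, hM.card_centralizer hux] at hcard
  have hTcard : Nat.card T + 1 = Nat.card (orbit H x) := by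
    have : Nat.card T = (orbit H x \ {x}).ncard := rfl
    rw [this, Set.ncard_sdiff_singleton_add_one (mem_orbit_self x) (Set.finite_range _)]
    rfl
  set k := Nat.card (Quotient (orbitRel C T))
  have hk1 : 1 ≤ k := by
    rcases Nat.eq_zero_or_pos k with h | h
    · rw [h] at hcard; omega
    · exact h
  have hk : k = 1 := by
    refine eq_one_of_orbit_equation (e := e) hq5 hc1 hcq hk1 ?_
    -- Here 2 + (1 + kq)(q - 2) = q(1 + k(q - 2)), so a factor q cancels.
    rw [← hg, hec, ← hTcard, hcard] at he
    refine Nat.eq_of_mul_eq_mul_left (show 0 < parabolicCount H x by omega) ?_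
    obtain ⟨r, hr⟩ : ∃ r, parabolicCount H x = r + 2 := ⟨parabolicCount H x - 2, by omega⟩
    rw [hr, Nat.add_sub_cancel] at he ⊢
    linarith
  refine ⟨by rw [← hTcard, hcard, hk, one_mul], fun y hy z hz hyx hzx => ?_⟩
  have hsub : Subsingleton (Quotient (orbitRel C T)) := by
    have : Finite (Quotient (orbitRel C T)) := Nat.finite_of_card_ne_zero (by omega)
    exact Finite.card_le_one_iff_subsingleton.1 hk.le
  have hrel := Quotient.exact (hsub.elim (Quotient.mk (orbitRel C T) ⟨z, hz, hzx⟩)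
    (Quotient.mk (orbitRel C T) ⟨y, hy, hyx⟩))
  obtain ⟨⟨h, hh⟩, hhy⟩ := hrel
  exact ⟨h, congrArg Subtype.val hhy, (hM.mem_centralizer_iff hux h).1 hh⟩

-- In terms of stabilizer orders, 1/e + 1/e₂ + 1/e₃ = 1 + 2/g. With e ≥ 4 the other two are {2,2} or
-- {2,3}; the first is the dihedral case n = 2, excluded by n ≥ 3. The second leaves e = 4
-- (octahedral, g = 24) and e = 5 (icosahedral).
omit hM in
lemma _root_.orbit_triple_bounds {g n n2 n3 e e2 e3 : ℕ} (h : n * e = g) (h2 : n2 * e2 = g)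
    (h3 : n3 * e3 = g) (hn : 3 ≤ n) (he : 4 ≤ e) (he2 : 2 ≤ e2) (he3 : 2 ≤ e3)
    (hsum : n + n2 + n3 = g + 2) : e ≤ 5 ∧ (e = 4 → n = 6) ∧ e2 ≤ 3 ∧ e3 ≤ 3 := by
  wlog hle : e2 ≤ e3 generalizing n2 n3 e2 e3
  · have := this h3 h2 he3 he2 (by omega) (by omega)
    tauto
  have b : ∀ {n e d : ℕ}, n * e = g → d ≤ e → n * d ≤ g := fun {n e d} h hd =>
    h ▸ Nat.mul_le_mul_left n hd
  have h4 := b h he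
  have he2' : e2 = 2 := by
    by_contra hne
    have h5 := b h2 (show 3 ≤ e2 by omega)
    have h6 := b h3 (show 3 ≤ e3 by omega)
    omega
  subst he2'
  have he3' : e3 ≤ 3 := by
    by_contra! hne
    have h6 := b h3 (show 4 ≤ e3 by omega)
    omega
  have he3'' : e3 = 3 := by
    by_contra hne
    obtain rfl : e3 = 2 := by omega
    omega
  subst he3''
  refine ⟨?_, ?_, by omega, by omega⟩
  · by_contra! hne
    have h7 := b h (show 6 ≤ e by omega)
    omega
  · rintro rfl
    omega

/-- The orbit equation in the absence of parabolic elements. -/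
theorem orbit_of_four_le_card_stabilizer [Finite H] (hq : ∀ y : X, parabolicCount H y = 1) {x : X}
    (hx : 4 ≤ Nat.card (stabilizer H x)) (hn : 3 ≤ Nat.card (orbit H x)) :
    Nat.card (stabilizer H x) ≤ 5 ∧
    (Nat.card (stabilizer H x) = 4 → Nat.card (orbit H x) = 6) ∧
    ∀ y : X, 4 ≤ Nat.card (stabilizer H y) → y ∈ orbit H x := by
  classical
  have hw : ∀ {T : Finset X}, (∀ y ∈ T, y ∈ poles H X) → 0 ≤ ∑ y ∈ T, poleWeight H y :=
    fun hT => sum_poleWeight_nonneg hT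
  have hpole : ∀ y : X, 4 ≤ Nat.card (stabilizer H y) → y ∈ poles H X := by
    intro y hy
    have : Nontrivial (stabilizer H y) := Finite.one_lt_card_iff_nontrivial.1 (by omega)
    obtain ⟨k, hk⟩ := exists_ne (1 : stabilizer H y)
    exact ⟨k, fun h => hk (Subtype.ext h), k.2⟩
  have hcard : ∀ {a y : X}, y ∈ orbit H a →
      Nat.card (stabilizer H y) = Nat.card (stabilizer H a) := by
    rintro a y ⟨h, rfl⟩
    exact card_stabilizer_smul h a
  have hsum := hM.sum_poleWeight
  obtain ⟨T1, hT1, hT1i, hm1, -, h1⟩ := sum_poleWeight_peel hM.finite_poles.toFinset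
    (fun h x hx => by simpa using smul_mem_poles h (by simpa using hx)) (x := x)
    (by simpa using hpole x hx)
  have hT1p : ∀ y ∈ T1, y ∈ poles H X := fun y hy => by simpa using hT1 hy
  have hg := card_orbit_mul_card_stabilizer (H := H) x
  have hle : 4 * Nat.card (orbit H x) ≤ Nat.card H := by
    rw [← hg, mul_comm]; exact Nat.mul_le_mul_left _ hx
  rw [hq] at h1
  push_cast at h1
  obtain ⟨x2, hx2⟩ : T1.Nonempty := by
    by_contra h0
    rw [Finset.not_nonempty_iff_eq_empty.1 h0, Finset.sum_empty] at h1
    omega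
  obtain ⟨T2, hT2, hT2i, hm2, -, h2⟩ := sum_poleWeight_peel T1 hT1i hx2
  have hT2p : ∀ y ∈ T2, y ∈ poles H X := fun y hy => hT1p y (hT2 hy)
  have hle2 := two_mul_card_orbit_le (hT1p x2 hx2)
  have hg2 := card_orbit_mul_card_stabilizer (H := H) x2
  have hn2 := card_orbit_pos (H := H) x2
  rw [hq] at h2
  push_cast at h2
  obtain ⟨x3, hx3⟩ : T2.Nonempty := by
    by_contra h0
    rw [Finset.not_nonempty_iff_eq_empty.1 h0, Finset.sum_empty] at h2
    omega
  obtain ⟨T3, hT3, hT3i, hm3, -, h3⟩ := sum_poleWeight_peel T2 hT2i hx3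
  have hT3p : ∀ y ∈ T3, y ∈ poles H X := fun y hy => hT2p y (hT3 hy)
  have hle3 := two_mul_card_orbit_le (hT2p x3 hx3)
  have hg3 := card_orbit_mul_card_stabilizer (H := H) x3
  rw [hq] at h3
  push_cast at h3
  -- Four orbits would contribute at least 3|H|/4 + 3·|H|/2, more than 2|H|.
  rcases T3.eq_empty_or_nonempty with rfl | ⟨x4, hx4⟩
  · rw [Finset.sum_empty] at h3
    obtain ⟨b1, b2, b3, b4⟩ := orbit_triple_bounds hg hg2 hg3 hn hx
      (two_le_card_stabilizer (hT1p x2 hx2)) (two_le_card_stabilizer (hT2p x3 hx3)) (by omega)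
    refine ⟨b1, b2, fun y hy => ?_⟩
    rcases (hm1 y).1 (by simpa using hpole y hy) with h | h
    · rcases (hm2 y).1 h with h | h
      · rcases (hm3 y).1 h with h | h
        · simp at h
        · have := hcard h; omega
      · have := hcard h; omega
    · exact h
  · exfalso
    obtain ⟨T4, hT4, -, -, -, h4⟩ := sum_poleWeight_peel T3 hT3i hx4
    have hs4 := hw fun y hy => hT3p y (hT4 hy)
    have hle4 := two_mul_card_orbit_le (hT3p x4 hx4)
    rw [hq] at h4
    push_cast at h4
    omega

end IsMoebiusLike

end OrbitCountConsequences

/-! ### Möbius transformations of the projective line. -/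

section Moebius

open Matrix

variable {F : Type*} [Field F]

/-- The element of `GL₂(F)` with the given entries. -/
def glOfEntries (a b c d : F) (h : a * d - b * c ≠ 0) : GL (Fin 2) F :=
  GeneralLinearGroup.mkOfDetNeZero !![a, b; c, d] (by simpa [det_fin_two_of] using h)

section
variable (a b c d : F) (h : a * d - b * c ≠ 0)
@[simp] lemma glOfEntries_zero_zero : glOfEntries a b c d h 0 0 = a := rfl
@[simp] lemma glOfEntries_zero_one : glOfEntries a b c d h 0 1 = b := rfl
@[simp] lemma glOfEntries_one_zero : glOfEntries a b c d h 1 0 = c := rfl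
@[simp] lemma glOfEntries_one_one : glOfEntries a b c d h 1 1 = d := rfl
end

lemma gl_det_ne_zero (m : GL (Fin 2) F) : m 0 0 * m 1 1 - m 0 1 * m 1 0 ≠ 0 := by
  rw [← det_fin_two]
  exact m.det_ne_zero

variable [DecidableEq F]

local notation "X" => OnePoint F
local notation "∞'" => (OnePoint.infty : OnePoint F)

lemma exists_gl_smul_eq_infty (x : X) : ∃ g : GL (Fin 2) F, g • x = ∞' := by
  cases x with
  | infty => exact ⟨1, one_smul _ _⟩
  | coe k =>
    exact ⟨glOfEntries 0 1 1 (-k) (by simp), by simp [OnePoint.smul_some_eq_ite]⟩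

/-- Any three distinct points of the projective line can be moved to `∞`, `0`, `1`. -/
lemma exists_gl_frame {x y z : X} (hxy : x ≠ y) (hxz : x ≠ z) (hyz : y ≠ z) :
    ∃ g : GL (Fin 2) F, g • x = ∞' ∧ g • y = ((0 : F) : X) ∧ g • z = ((1 : F) : X) := by
  obtain ⟨g, hg⟩ := exists_gl_smul_eq_infty x
  have hy : g • y ≠ ∞' := fun h => hxy (MulAction.injective g (hg.trans h.symm))
  have hz : g • z ≠ ∞' := fun h => hxz (MulAction.injective g (hg.trans h.symm))
  obtain ⟨b, hb⟩ := OnePoint.ne_infty_iff_exists.1 hy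
  obtain ⟨c, hc⟩ := OnePoint.ne_infty_iff_exists.1 hz
  have hbc : c - b ≠ 0 := by
    intro h
    refine hyz (MulAction.injective g ?_)
    change g • y = g • z
    rw [← hb, ← hc, sub_eq_zero.1 h]
  refine ⟨glOfEntries 1 (-b) 0 (c - b) (by simpa using hbc) * g, ?_, ?_, ?_⟩
  · rw [mul_smul, hg]; simp [OnePoint.smul_infty_eq_ite]
  · rw [mul_smul, ← hb]; simp [OnePoint.smul_some_eq_ite, hbc]
  · rw [mul_smul, ← hc]
    simp [OnePoint.smul_some_eq_ite, hbc, ← sub_eq_add_neg]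

lemma smul_eq_self_of_frame {m : GL (Fin 2) F} (h1 : m • ∞' = ∞')
    (h2 : m • ((0 : F) : X) = ((0 : F) : X)) (h3 : m • ((1 : F) : X) = ((1 : F) : X)) (w : X) :
    m • w = w := by
  have hdet := gl_det_ne_zero m
  have hc : m 1 0 = 0 := OnePoint.smul_infty_eq_self_iff.1 h1
  have hd : m 1 1 ≠ 0 := by rintro h; simp [h, hc] at hdet
  simp only [OnePoint.smul_some_eq_ite, hc, zero_add, hd, if_false, mul_zero, mul_one,
    OnePoint.coe_eq_coe] at h2 h3
  have hb : m 0 1 = 0 := by simpa [hd] using h2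
  have ha : m 0 0 = m 1 1 := by rw [hb, add_zero, div_eq_iff hd, one_mul] at h3; exact h3
  cases w with
  | infty => exact h1
  | coe k =>
    simp [OnePoint.smul_some_eq_ite, hc, hb, hd, ha]

lemma smul_eq_self_of_three {m : GL (Fin 2) F} {x y z : X} (hxy : x ≠ y) (hxz : x ≠ z)
    (hyz : y ≠ z) (hx : m • x = x) (hy : m • y = y) (hz : m • z = z) (w : X) : m • w = w := by
  obtain ⟨g, h1, h2, h3⟩ := exists_gl_frame hxy hxz hyz
  have := smul_eq_self_of_frame (m := g * m * g⁻¹) (by rw [← h1]; simp [mul_smul, hx])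
    (by rw [← h2]; simp [mul_smul, hy]) (by rw [← h3]; simp [mul_smul, hz]) (g • w)
  simpa [mul_smul] using this

lemma exists_smul_eq_self [IsAlgClosed F] (m : GL (Fin 2) F) : ∃ x : X, m • x = x := by
  by_cases hc : m 1 0 = 0
  · exact ⟨∞', OnePoint.smul_infty_eq_self_iff.2 hc⟩
  · let P : Polynomial F := Polynomial.C (m 1 0) * Polynomial.X ^ 2 +
      Polynomial.C (m 1 1 - m 0 0) * Polynomial.X + Polynomial.C (- m 0 1)
    have hP : P.degree = 2 := Polynomial.degree_quadratic hc
    obtain ⟨k, hk⟩ := IsAlgClosed.exists_root P (by rw [hP]; decide)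
    refine ⟨(k : X), ?_⟩
    have hk' : m 1 0 * k ^ 2 + (m 1 1 - m 0 0) * k + - m 0 1 = 0 := by
      simpa [P, Polynomial.IsRoot] using hk
    have hdet := gl_det_ne_zero m
    -- At a root of the fixed-point quadratic, a vanishing denominator would make the numerator
    -- vanish too, contradicting invertibility.
    have hne : m 1 0 * k + m 1 1 ≠ 0 := by
      intro h
      apply hdet
      have h2 : m 0 0 * k + m 0 1 = 0 := by linear_combination k * h - hk'
      have : m 1 0 * (m 0 0 * m 1 1 - m 0 1 * m 1 0) = 0 := by
        linear_combination (m 1 0 * m 0 0) * h - m 1 0 ^ 2 * h2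
      exact (mul_eq_zero.1 this).resolve_left hc
    rw [OnePoint.smul_some_eq_ite, if_neg hne, OnePoint.coe_eq_coe, div_eq_iff hne]
    linear_combination -hk'

/-- An upper triangular matrix with distinct diagonal entries a, d has the second fixed point b/(d -
a). -/
lemma entries_of_fixedBy_eq_infty {m : GL (Fin 2) F} (h : fixedBy X m = {∞'}) :
    m 1 0 = 0 ∧ m 0 0 = m 1 1 := by
  have hfix : ∀ z : X, m • z = z ↔ z = ∞' := fun z => by
    rw [← mem_fixedBy, h, Set.mem_singleton_iff]
  have hc : m 1 0 = 0 := OnePoint.smul_infty_eq_self_iff.1 ((hfix _).2 rfl)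
  have hdet := gl_det_ne_zero m
  have hd : m 1 1 ≠ 0 := by rintro h; simp [h, hc] at hdet
  refine ⟨hc, ?_⟩
  by_contra hne
  have hne' : m 1 1 - m 0 0 ≠ 0 := fun h => hne (sub_eq_zero.1 h).symm
  have := (hfix ((m 0 1 / (m 1 1 - m 0 0) : F) : X)).1 (by
    rw [OnePoint.smul_some_eq_ite, if_neg (by simpa [hc] using hd), OnePoint.coe_eq_coe, hc]
    field_simp
    ring)
  simp at this

lemma entries_of_fixedBy_eq_zero {m : GL (Fin 2) F} (h : fixedBy X m = {((0 : F) : X)}) :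
    m 0 1 = 0 ∧ m 0 0 = m 1 1 := by
  have hfix : ∀ z : X, m • z = z ↔ z = ((0 : F) : X) := fun z => by
    rw [← mem_fixedBy, h, Set.mem_singleton_iff]
  have hdet := gl_det_ne_zero m
  have hb : m 0 1 = 0 := by
    have h0 := (hfix _).2 rfl
    by_contra hb
    by_cases hd : m 1 1 = 0
    · simp [OnePoint.smul_some_eq_ite, hd] at h0
    · simp [OnePoint.smul_some_eq_ite, hd, hb] at h0
  refine ⟨hb, ?_⟩
  have ha : m 0 0 ≠ 0 := by rintro h; simp [h, hb] at hdet
  by_contra hne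
  have hne' : m 0 0 - m 1 1 ≠ 0 := sub_ne_zero.2 hne
  by_cases hc : m 1 0 = 0
  · have := (hfix ∞').1 (OnePoint.smul_infty_eq_self_iff.2 hc)
    simp at this
  · have h1 : m 1 0 * ((m 0 0 - m 1 1) / m 1 0) + m 1 1 = m 0 0 := by field_simp; ring
    have := (hfix (((m 0 0 - m 1 1) / m 1 0 : F) : X)).1 (by
      rw [OnePoint.smul_some_eq_ite, h1, if_neg ha, OnePoint.coe_eq_coe, hb, add_zero,
        mul_div_cancel_left₀ _ ha])
    simp [hc, hne'] at this

lemma smul_coe_of_entries {m : GL (Fin 2) F} (hc : m 1 0 = 0) (ha : m 0 0 = m 1 1) (k : F) :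
    m • (k : X) = ((k + m 0 1 / m 1 1 : F) : X) := by
  have hdet := gl_det_ne_zero m
  have hd : m 1 1 ≠ 0 := by rintro h; simp [h, hc] at hdet
  rw [OnePoint.smul_some_eq_ite, if_neg (by simpa [hc] using hd), OnePoint.coe_eq_coe, hc, ha, zero_mul,
    zero_add]
  field_simp

open scoped Pointwise in
lemma fixedBy_conj_gl (g m : GL (Fin 2) F) {x y : X} (hg : g • x = y) (h : fixedBy X m = {x}) :
    fixedBy X (g * m * g⁻¹) = {y} := by
  rw [← smul_fixedBy, h, Set.smul_set_singleton, hg]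

/-- Once the common fixed point is moved to ∞, both matrices are scalar multiples of translations.
-/
lemma mul_comm_of_fixedBy {m k : GL (Fin 2) F} {x : X} (hm : fixedBy X m = {x})
    (hk : fixedBy X k = {x}) : m * k = k * m := by
  obtain ⟨g, hg⟩ := exists_gl_smul_eq_infty x
  obtain ⟨h1, h2⟩ := entries_of_fixedBy_eq_infty (fixedBy_conj_gl g m hg hm)
  obtain ⟨h3, h4⟩ := entries_of_fixedBy_eq_infty (fixedBy_conj_gl g k hg hk)
  have h5 : (g * m * g⁻¹) * (g * k * g⁻¹) = (g * k * g⁻¹) * (g * m * g⁻¹) := by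
    generalize g * m * g⁻¹ = a at *
    generalize g * k * g⁻¹ = b at *
    ext i j
    fin_cases i <;> fin_cases j <;>
      simp [Matrix.mul_apply, Fin.sum_univ_two, h1, h2, h3, h4, mul_comm, add_comm]
  have h6 : g * (m * k) * g⁻¹ = g * (k * m) * g⁻¹ := by
    calc g * (m * k) * g⁻¹ = (g * m * g⁻¹) * (g * k * g⁻¹) := by group
      _ = _ := h5
      _ = _ := by group
  exact mul_left_cancel (mul_right_cancel h6)

lemma pow_smul_of_fixedBy {p : ℕ} [CharP F p] {m : GL (Fin 2) F} {x : X}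
    (hm : fixedBy X m = {x}) (w : X) : m ^ p • w = w := by
  obtain ⟨g, hg⟩ := exists_gl_smul_eq_infty x
  obtain ⟨h1, h2⟩ := entries_of_fixedBy_eq_infty (fixedBy_conj_gl g m hg hm)
  have h3 : ∀ v : X, (g * m * g⁻¹) ^ p • v = v := by
    generalize g * m * g⁻¹ = a at *
    intro v
    cases v with
    | infty =>
      have : ∀ n : ℕ, a ^ n • ∞' = ∞' := by
        intro n
        induction n with
        | zero => simp
        | succ n ih => rw [pow_succ, mul_smul, OnePoint.smul_infty_eq_self_iff.2 h1, ih]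
      exact this p
    | coe k =>
      have : ∀ n : ℕ, ∀ k : F, a ^ n • (k : X) = ((k + n * (a 0 1 / a 1 1) : F) : X) := by
        intro n
        induction n with
        | zero => simp
        | succ n ih =>
          intro k
          rw [pow_succ, mul_smul, smul_coe_of_entries h1 h2, ih]
          push_cast
          congr 1
          ring
      rw [this p k]
      simp
  have h4 := h3 (g • w)
  rw [conj_pow] at h4
  simpa [mul_smul] using h4

/-- The group of Möbius transformations defined by a group of matrices. -/
abbrev moebiusGroup (Γ : Subgroup (GL (Fin 2) F)) : Subgroup (Equiv.Perm X) :=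
  Γ.map (toPermHom (GL (Fin 2) F) X)

lemma exists_mem_of_moebiusGroup {Γ : Subgroup (GL (Fin 2) F)} (h : moebiusGroup Γ) :
    ∃ m ∈ Γ, ∀ x : X, h • x = m • x := by
  obtain ⟨h, m, hm, rfl⟩ := h
  exact ⟨m, hm, fun x => rfl⟩

/-- The Möbius transformation defined by a matrix. -/
def toMoebius {Γ : Subgroup (GL (Fin 2) F)} (m : GL (Fin 2) F) (hm : m ∈ Γ) : moebiusGroup Γ :=
  ⟨toPermHom (GL (Fin 2) F) X m, m, hm, rfl⟩

@[simp] lemma toMoebius_smul {Γ : Subgroup (GL (Fin 2) F)} (m : GL (Fin 2) F) (hm : m ∈ Γ) (x : X) :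
    toMoebius m hm • x = m • x := rfl

lemma moebius_ext {Γ : Subgroup (GL (Fin 2) F)} {h k : moebiusGroup Γ}
    (hk : ∀ x : X, h • x = k • x) : h = k :=
  Subtype.ext (Equiv.ext hk)

theorem isMoebiusLike_moebiusGroup (p : ℕ) [CharP F p] [IsAlgClosed F]
    (Γ : Subgroup (GL (Fin 2) F)) : IsMoebiusLike p (moebiusGroup Γ) X where
  exists_fixed h := by
    obtain ⟨m, -, hm⟩ := exists_mem_of_moebiusGroup h
    simpa only [hm] using exists_smul_eq_self m
  eq_one_of_three h x y z hxy hxz hyz hx hy hz := by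
    obtain ⟨m, -, hm⟩ := exists_mem_of_moebiusGroup h
    refine moebius_ext fun w => ?_
    rw [hm] at *
    rw [one_smul]
    exact smul_eq_self_of_three hxy hxz hyz hx hy hz w
  commute_of_parabolic h k x hh hk := by
    obtain ⟨m, -, hm⟩ := exists_mem_of_moebiusGroup h
    obtain ⟨n, -, hn⟩ := exists_mem_of_moebiusGroup k
    have h1 : fixedBy X m = {x} := by rw [← hh]; ext z; simp [hm]
    have h2 : fixedBy X n = {x} := by rw [← hk]; ext z; simp [hn]
    have h3 := mul_comm_of_fixedBy h1 h2
    refine moebius_ext fun w => ?_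
    rw [mul_smul, mul_smul, hn, hm, hm, hn, ← mul_smul, h3, mul_smul]
  pow_eq_one h x hh := by
    obtain ⟨m, -, hm⟩ := exists_mem_of_moebiusGroup h
    have h1 : fixedBy X m = {x} := by rw [← hh]; ext z; simp [hm]
    have h2 : ∀ n : ℕ, ∀ w : X, h ^ n • w = m ^ n • w := by
      intro n
      induction n with
      | zero => simp
      | succ n ih => intro w; rw [pow_succ, mul_smul, hm, ih, pow_succ, mul_smul]
    refine moebius_ext fun w => ?_
    rw [h2, pow_smul_of_fixedBy h1, one_smul]

end Moebius

/-! ### The parabolic case: the orbit is a projective line over a subfield. -/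

section ParabolicCase

open Matrix

variable {F : Type*} [Field F]

/-- Hua's theorem on additive subgroups closed under inversion, in a form adapted to unipotent
Möbius transformations. -/
theorem AddSubgroup.exists_subfield_of_harmonic (h2 : (2 : F) ≠ 0) (S : AddSubgroup F)
    (h1 : (1 : F) ∈ S)
    (hS : ∀ a ∈ S, ∀ c ∈ S, c ≠ 0 → a + c ≠ 0 → a * c / (a + c) ∈ S) :
    ∃ A : Subfield F, ∀ a, a ∈ A ↔ a ∈ S := by
  have hinv : ∀ x ∈ S, x⁻¹ ∈ S := by
    intro x hx
    rcases eq_or_ne x 0 with rfl | hx0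
    · simp
    rcases eq_or_ne x 1 with rfl | hx1
    · simpa using hx
    -- The harmonic sum of 1 and x - 1 is 1 - 1/x.
    have h3 := hS 1 h1 (x - 1) (S.sub_mem hx h1) (sub_ne_zero.2 hx1) (by simpa using hx0)
    have h4 : x⁻¹ = 1 - 1 * (x - 1) / (1 + (x - 1)) := by
      rw [add_sub_cancel]; field_simp; ring
    rw [h4]
    exact S.sub_mem h1 h3
  have hsq : ∀ x ∈ S, x * x ∈ S := by
    intro x hx
    rcases eq_or_ne x 0 with rfl | hx0
    · simp
    rcases eq_or_ne (x + 1) 0 with hx1 | hx1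
    · rw [eq_neg_of_add_eq_zero_left hx1]; simpa using h1
    have h3 := hinv _ (S.sub_mem (hinv x hx) (hinv _ (S.add_mem hx h1)))
    -- Hua's identity produces squares from inverses; products then follow by polarization, up to
    -- the factor 2.
    have h4 : (x⁻¹ - (x + 1)⁻¹)⁻¹ = x * x + x := by
      have : x⁻¹ - (x + 1)⁻¹ = (x * x + x)⁻¹ := by
        have : x * x + x = x * (x + 1) := by ring
        rw [this]; field_simp; ring
      rw [this, inv_inv]
    rw [h4] at h3
    simpa using S.sub_mem h3 hx
  have hmul : ∀ x ∈ S, ∀ y ∈ S, x * y ∈ S := by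
    intro x hx y hy
    have h3 : 2 * (x * y) ∈ S := by
      have := S.sub_mem (S.sub_mem (hsq _ (S.add_mem hx hy)) (hsq x hx)) (hsq y hy)
      convert this using 1; ring
    -- The factor 2 is removed by doubling the inverse of 2xy and inverting again.
    have h4 := hinv _ h3
    have h5 := hinv _ (S.add_mem h4 h4)
    have h6 : ((2 * (x * y))⁻¹ + (2 * (x * y))⁻¹)⁻¹ = x * y := by
      rw [← two_mul, mul_inv 2 (x * y), ← mul_assoc, mul_inv_cancel₀ h2, one_mul, inv_inv]
    rwa [h6] at h5
  let A : Subfield F :=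
    { carrier := S
      mul_mem' := fun ha hb => hmul _ ha _ hb
      one_mem' := h1
      add_mem' := S.add_mem
      zero_mem' := S.zero_mem
      neg_mem' := S.neg_mem
      inv_mem' := fun x hx => hinv x hx }
  exact ⟨A, fun a => Iff.rfl⟩

variable [DecidableEq F]

local notation "X" => OnePoint F
local notation "∞'" => (OnePoint.infty : OnePoint F)

/-- The projective line over a subfield. -/
def subfieldLine (A : Subfield F) : Set X := {w | w = ∞' ∨ ∃ a ∈ A, w = (a : X)}

lemma entries_of_smul_eq_self {m : GL (Fin 2) F} (h : ∀ x : X, m • x = x) :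
    m 1 0 = 0 ∧ m 0 1 = 0 ∧ m 0 0 = m 1 1 := by
  have hdet := gl_det_ne_zero m
  have hc : m 1 0 = 0 := OnePoint.smul_infty_eq_self_iff.1 (h _)
  have hd : m 1 1 ≠ 0 := by rintro h; simp [h, hc] at hdet
  have h0 := h ((0 : F) : X)
  have h1 := h ((1 : F) : X)
  simp only [OnePoint.smul_some_eq_ite, hc, zero_add, hd, if_false, mul_zero, mul_one,
    OnePoint.coe_eq_coe] at h0 h1
  have hb : m 0 1 = 0 := by simpa [hd] using h0
  refine ⟨hc, hb, ?_⟩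
  rw [hb, add_zero, div_eq_iff hd, one_mul] at h1; exact h1

/-- A finite group of Möbius transformations in characteristic `p ≥ 5` which contains a parabolic
element and does not fix its fixed point contains, up to conjugation, `PSL₂` of a subfield, and
preserves the projective line over that subfield. -/
theorem exists_subfield_of_parabolic (p : ℕ) [Fact p.Prime] (hp : 5 ≤ p) [CharP F p]
    [IsAlgClosed F] (Γ : Subgroup (GL (Fin 2) F)) [Finite Γ] {P : X}
    (hq : 1 < parabolicCount (moebiusGroup Γ) P)
    (hn : 2 ≤ Nat.card (orbit (moebiusGroup Γ) P)) :
    ∃ (g : GL (Fin 2) F) (A : Subfield F),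
      (∀ m ∈ Γ, ∀ w ∈ subfieldLine A, (g * m * g⁻¹) • w ∈ subfieldLine A) ∧
      (∀ a ∈ A, ∃ m ∈ Γ, (g * m * g⁻¹) 1 0 = 0 ∧ (g * m * g⁻¹) 0 0 = (g * m * g⁻¹) 1 1 ∧
        (g * m * g⁻¹) 0 1 = a * (g * m * g⁻¹) 1 1) ∧
      (∀ a ∈ A, ∃ m ∈ Γ, (g * m * g⁻¹) 0 1 = 0 ∧ (g * m * g⁻¹) 0 0 = (g * m * g⁻¹) 1 1 ∧
        (g * m * g⁻¹) 1 0 = a * (g * m * g⁻¹) 1 1) := by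
  have hM := isMoebiusLike_moebiusGroup p Γ
  have hfinH : Finite (moebiusGroup Γ) :=
    Finite.of_surjective _ (MonoidHom.subgroupMap_surjective _ Γ)
  set O := orbit (moebiusGroup Γ) P with hO
  have hOinv : ∀ m ∈ Γ, ∀ v, v ∈ O → m • v ∈ O := by
    intro m hm v hv
    have : toMoebius m hm • v ∈ orbit (moebiusGroup Γ) P := by
      rw [← orbit_eq_iff, orbit_smul, orbit_eq_iff]; exact hv
    exact this
  have htrans : ∀ x ∈ O, ∀ y ∈ O, ∀ z ∈ O, y ≠ x → z ≠ x →
      ∃ m ∈ Γ, m • y = z ∧ ((∀ w : X, m • w = w) ∨ fixedBy X m = {x}) := by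
    intro x hx y hy z hz hyx hzx
    have hox : orbit (moebiusGroup Γ) x = O := orbit_eq_iff.2 hx
    have hqx : parabolicCount (moebiusGroup Γ) x = parabolicCount (moebiusGroup Γ) P := by
      obtain ⟨h, rfl⟩ := hx
      exact parabolicCount_smul h P
    obtain ⟨-, h⟩ := hM.exists_parabolic_smul_eq hp (x := x) (by rw [hqx]; exact hq)
      (by rw [hox]; exact hn)
    obtain ⟨h, hyz, hh⟩ := h y (hox ▸ hy) z (hox ▸ hz) hyx hzx
    obtain ⟨m, hm, hmh⟩ := exists_mem_of_moebiusGroup h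
    refine ⟨m, hm, by rw [← hmh, hyz], hh.imp ?_ ?_⟩
    · rintro rfl w
      rw [← hmh, one_smul]
    · intro h1
      rw [← h1]; ext z; simp [hmh]
  have hcard := (hM.exists_parabolic_smul_eq hp hq hn).1
  have hge := hM.le_parabolicCount hq
  obtain ⟨x, hx, y, hy, z, hz, hxy, hxz, hyz⟩ : ∃ x ∈ O, ∃ y ∈ O, ∃ z ∈ O,
      x ≠ y ∧ x ≠ z ∧ y ≠ z := by
    have h3 : 2 < O.ncard := by
      have : O.ncard = Nat.card O := rfl
      rw [this, hcard]
      omega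
    obtain ⟨x, hx, y, hy, z, hz, h⟩ := (Set.two_lt_ncard (Set.finite_range _)).1 h3
    exact ⟨x, hx, y, hy, z, hz, h⟩
  obtain ⟨g, hgx, hgy, hgz⟩ := exists_gl_frame hxy hxz hyz
  have hinv : ∀ m ∈ Γ, ∀ v, g⁻¹ • v ∈ O → g⁻¹ • ((g * m * g⁻¹) • v) ∈ O := by
    intro m hm v hv
    have := hOinv m hm _ hv
    simpa [mul_smul] using this
  have hinvm : ∀ m ∈ Γ, ∀ v, g⁻¹ • ((g * m * g⁻¹) • v) ∈ O → g⁻¹ • v ∈ O := by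
    intro m hm v hv
    have := hOinv _ (Γ.inv_mem hm) _ hv
    simpa [mul_smul] using this
  have htrans' : ∀ x, g⁻¹ • x ∈ O → ∀ y, g⁻¹ • y ∈ O → ∀ z, g⁻¹ • z ∈ O → y ≠ x → z ≠ x →
      ∃ m ∈ Γ, (g * m * g⁻¹) • y = z ∧
        ((∀ w : X, (g * m * g⁻¹) • w = w) ∨ fixedBy X (g * m * g⁻¹) = {x}) := by
    intro x hx y hy z hz hyx hzx
    obtain ⟨m, hm, hyz, h⟩ := htrans _ hx _ hy _ hz (by simpa using hyx) (by simpa using hzx)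
    refine ⟨m, hm, by simp [mul_smul, hyz], h.imp ?_ ?_⟩
    · intro h w
      simp [mul_smul, h]
    · intro h
      exact fixedBy_conj_gl g m (by simp) h
  have hOinf : g⁻¹ • ∞' ∈ O := by rw [← hgx]; simpa using hx
  have hO0 : g⁻¹ • ((0 : F) : X) ∈ O := by rw [← hgy]; simpa using hy
  have hO1 : g⁻¹ • ((1 : F) : X) ∈ O := by rw [← hgz]; simpa using hz
  have hupper : ∀ a : F, g⁻¹ • (a : X) ∈ O → ∃ m ∈ Γ, (g * m * g⁻¹) 1 0 = 0 ∧
      (g * m * g⁻¹) 0 0 = (g * m * g⁻¹) 1 1 ∧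
      (g * m * g⁻¹) 0 1 = a * (g * m * g⁻¹) 1 1 := by
    intro a ha
    obtain ⟨m, hm, h0, h⟩ := htrans' _ hOinf _ hO0 _ ha (OnePoint.coe_ne_infty _)
      (OnePoint.coe_ne_infty _)
    have h1 : (g * m * g⁻¹) 1 0 = 0 ∧ (g * m * g⁻¹) 0 0 = (g * m * g⁻¹) 1 1 := by
      rcases h with h | h
      · exact ⟨(entries_of_smul_eq_self h).1, (entries_of_smul_eq_self h).2.2⟩
      · exact entries_of_fixedBy_eq_infty h
    refine ⟨m, hm, h1.1, h1.2, ?_⟩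
    have hdet := gl_det_ne_zero (g * m * g⁻¹)
    have hd : (g * m * g⁻¹) 1 1 ≠ 0 := by rintro h; simp [h, h1.1] at hdet
    rw [smul_coe_of_entries h1.1 h1.2, OnePoint.coe_eq_coe, zero_add, div_eq_iff hd] at h0
    exact h0
  -- The unipotent map fixing 0 and sending ∞ to c is z ↦ cz/(z + c), the source of the harmonic
  -- condition; the translations in `hupper` give closure under addition.
  have hlower : ∀ c : F, c ≠ 0 → g⁻¹ • (c : X) ∈ O → ∃ m ∈ Γ, (g * m * g⁻¹) 0 1 = 0 ∧
      (g * m * g⁻¹) 0 0 = (g * m * g⁻¹) 1 1 ∧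
      (g * m * g⁻¹) 1 0 * c = (g * m * g⁻¹) 1 1 := by
    intro c hc0 hc
    obtain ⟨m, hm, h0, h⟩ := htrans' _ hO0 _ hOinf _ hc (OnePoint.infty_ne_coe _)
      (by simpa using hc0)
    have h1 : (g * m * g⁻¹) 0 1 = 0 ∧ (g * m * g⁻¹) 0 0 = (g * m * g⁻¹) 1 1 := by
      rcases h with h | h
      · exact ⟨(entries_of_smul_eq_self h).2.1, (entries_of_smul_eq_self h).2.2⟩
      · exact entries_of_fixedBy_eq_zero h
    refine ⟨m, hm, h1.1, h1.2, ?_⟩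
    rw [OnePoint.smul_infty_eq_ite] at h0
    split_ifs at h0 with hcc
    · exact absurd h0 (OnePoint.infty_ne_coe _)
    · rw [OnePoint.coe_eq_coe, div_eq_iff hcc] at h0
      rw [← h1.2, h0, mul_comm]
  let S : AddSubgroup F :=
    { carrier := {a | g⁻¹ • (a : X) ∈ O}
      zero_mem' := hO0
      add_mem' := by
        intro a b ha hb
        obtain ⟨m, hm, h1, h2, h3⟩ := hupper a ha
        have hdet := gl_det_ne_zero (g * m * g⁻¹)
        have hd : (g * m * g⁻¹) 1 1 ≠ 0 := by rintro h; simp [h, h1] at hdet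
        have := hinv m hm _ hb
        rw [smul_coe_of_entries h1 h2, h3, mul_div_cancel_right₀ _ hd, add_comm] at this
        exact this
      neg_mem' := by
        intro a ha
        obtain ⟨m, hm, h1, h2, h3⟩ := hupper a ha
        have hdet := gl_det_ne_zero (g * m * g⁻¹)
        have hd : (g * m * g⁻¹) 1 1 ≠ 0 := by rintro h; simp [h, h1] at hdet
        refine hinvm m hm _ ?_
        rw [smul_coe_of_entries h1 h2, h3, mul_div_cancel_right₀ _ hd, neg_add_cancel]
        exact hO0 }
  have hSmem : ∀ a, a ∈ S ↔ g⁻¹ • (a : X) ∈ O := fun a => Iff.rfl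
  have h2 : (2 : F) ≠ 0 := by
    have h3 : ¬ p ∣ 2 := fun h => by have := Nat.le_of_dvd (by norm_num) h; omega
    exact_mod_cast fun h => h3 ((CharP.cast_eq_zero_iff F p 2).1 h)
  obtain ⟨A, hA⟩ := S.exists_subfield_of_harmonic h2 hO1 (by
    intro a ha c hc hc0 hac
    obtain ⟨m, hm, h1, h2, h3⟩ := hlower c hc0 hc
    have := hinv m hm _ ha
    generalize g * m * g⁻¹ = m' at *
    have hdet := gl_det_ne_zero m'
    have hc1 : m' 1 0 ≠ 0 := by rintro h; simp [h2, ← h3, h, h1] at hdet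
    have h4 : m' 1 0 * a + m' 1 1 = m' 1 0 * (a + c) := by rw [← h3]; ring
    rw [OnePoint.smul_some_eq_ite, h4, if_neg (mul_ne_zero hc1 hac), h1, h2, ← h3, add_zero,
      mul_assoc, mul_div_mul_left _ _ hc1, mul_comm c a] at this
    exact this)
  refine ⟨g, A, ?_, fun a ha => hupper a ((hA a).1 ha), fun a ha => ?_⟩
  · have hline : ∀ w, w ∈ subfieldLine A ↔ g⁻¹ • w ∈ O := by
      intro w
      cases w with
      | infty => exact ⟨fun _ => hOinf, fun _ => Or.inl rfl⟩
      | coe k =>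
        rw [← hSmem, ← hA]
        simp [subfieldLine]
    intro m hm w hw
    exact (hline _).2 (hinv m hm w ((hline w).1 hw))
  · rcases eq_or_ne a 0 with rfl | ha0
    · exact ⟨1, Γ.one_mem, by simp⟩
    · obtain ⟨m, hm, h1, h2, h3⟩ := hlower a⁻¹ (inv_ne_zero ha0) ((hA _).1 (A.inv_mem ha))
      refine ⟨m, hm, h1, h2, ?_⟩
      rw [← h3]; field_simp

end ParabolicCase

/-! ### The extension by the split torus and its second torus. -/

section TorusExtension

open Matrix

variable {k F : Type*} [Field k] [Field F] [Algebra k F] {K : IntermediateField k F}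

/-- The embedding of `SL₂(K)` into `GL₂(F)` for a subextension `K` of `F`. -/
def slToGL (K : IntermediateField k F) : SpecialLinearGroup (Fin 2) K →* GL (Fin 2) F :=
  SpecialLinearGroup.toGL.comp (SpecialLinearGroup.map (algebraMap K F))

@[simp] lemma slToGL_apply (s : SpecialLinearGroup (Fin 2) K) (i j : Fin 2) :
    slToGL K s i j = (s i j : F) := rfl

lemma slToGL_injective : Function.Injective (slToGL K) := by
  intro s t h
  ext i j
  have : slToGL K s i j = slToGL K t i j := by rw [h]
  simpa using this

/-- The split torus `diag(u, 1)` over `k`. -/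
def diagTorus (k F : Type*) [Field k] [Field F] [Algebra k F] : kˣ →* GL (Fin 2) F where
  toFun u := glOfEntries (algebraMap k F u) 0 0 1 (by simp)
  map_one' := by ext i j; fin_cases i <;> fin_cases j <;> simp
  map_mul' u v := by
    ext i j; fin_cases i <;> fin_cases j <;> simp [Matrix.mul_apply, Fin.sum_univ_two]

section
variable (u : kˣ)
@[simp] lemma diagTorus_zero_zero : diagTorus k F u 0 0 = algebraMap k F u := rfl
@[simp] lemma diagTorus_zero_one : diagTorus k F u 0 1 = 0 := rfl
@[simp] lemma diagTorus_one_zero : diagTorus k F u 1 0 = 0 := rfl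
@[simp] lemma diagTorus_one_one : diagTorus k F u 1 1 = 1 := rfl
end

/-- The matrix `(1, s⁻¹; 0, 1) (1, 0; sθ, 1)`. -/
def halfGenerator (t : K) (s : kˣ) : SpecialLinearGroup (Fin 2) K :=
  upperUnipotent (algebraMap k K (s : k))⁻¹ * lowerUnipotent (algebraMap k K (s : k) * t)

@[simp] lemma upperUnipotent_coe {E : Type*} [Field E] (x : E) :
    (upperUnipotent x : Matrix (Fin 2) (Fin 2) E) = !![1, x; 0, 1] := rfl

@[simp] lemma lowerUnipotent_coe {E : Type*} [Field E] (x : E) :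
    (lowerUnipotent x : Matrix (Fin 2) (Fin 2) E) = !![1, 0; x, 1] := rfl

lemma upperUnipotent_neg (x : K) : upperUnipotent (-x) = (upperUnipotent x)⁻¹ := by
  rw [eq_inv_iff_mul_eq_one]
  ext i j
  fin_cases i <;> fin_cases j <;> simp [Matrix.mul_apply, Fin.sum_univ_two]

lemma lowerUnipotent_neg (x : K) : lowerUnipotent (-x) = (lowerUnipotent x)⁻¹ := by
  rw [eq_inv_iff_mul_eq_one]
  ext i j
  fin_cases i <;> fin_cases j <;> simp [Matrix.mul_apply, Fin.sum_univ_two]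

lemma scalarGenerator_eq (t : K) (r s : kˣ) :
    scalarGenerator t r s = (halfGenerator t r)⁻¹ * halfGenerator t s := by
  rw [scalarGenerator, lowerUnipotent_neg, upperUnipotent_neg, halfGenerator, halfGenerator]
  group

lemma halfGenerator_coe (t : K) (s : kˣ) : (halfGenerator t s : Matrix (Fin 2) (Fin 2) K) =
    !![1 + t, (algebraMap k K (s : k))⁻¹; algebraMap k K (s : k) * t, 1] := by
  ext i j
  fin_cases i <;> fin_cases j <;>
    simp [halfGenerator, Matrix.mul_apply, Fin.sum_univ_two]

lemma diagTorus_mul_halfGenerator (t : K) (u s : kˣ) :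
    diagTorus k F u * slToGL K (halfGenerator t s) =
      slToGL K (halfGenerator t (s * u⁻¹)) * diagTorus k F u := by
  ext i j
  fin_cases i <;> fin_cases j <;>
    simp [Matrix.mul_apply, Fin.sum_univ_two, halfGenerator_coe, mul_comm]
  field_simp

lemma diagTorus_conj_scalarGenerator (t : K) (u r s : kˣ) :
    diagTorus k F u * slToGL K (scalarGenerator t r s) * (diagTorus k F u)⁻¹ =
      slToGL K (scalarGenerator t (r * u⁻¹) (s * u⁻¹)) := by
  have h : ∀ s, slToGL K (halfGenerator t (s * u⁻¹)) =
      diagTorus k F u * slToGL K (halfGenerator t s) * (diagTorus k F u)⁻¹ := fun s => by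
    rw [diagTorus_mul_halfGenerator]; group
  rw [scalarGenerator_eq, scalarGenerator_eq, map_mul, map_mul, map_inv, map_inv, h, h]
  group

/-- The group generated by all matrices `M_θ(r, s)`. -/
abbrev scalarGroup (t : K) : Subgroup (SpecialLinearGroup (Fin 2) K) :=
  Subgroup.closure {g | ∃ r s : kˣ, g = scalarGenerator t r s}

lemma diagTorus_conj_mem (t : K) (u : kˣ) {s : SpecialLinearGroup (Fin 2) K}
    (hs : s ∈ scalarGroup t) :
    ∃ s' ∈ scalarGroup t, diagTorus k F u * slToGL K s * (diagTorus k F u)⁻¹ = slToGL K s' := by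
  have h : scalarGroup t ≤ ((scalarGroup t).map (slToGL K)).comap
      ((MulAut.conj (diagTorus k F u)).toMonoidHom.comp (slToGL K)) := by
    rw [scalarGroup, Subgroup.closure_le]
    rintro _ ⟨r, s, rfl⟩
    exact ⟨_, Subgroup.subset_closure ⟨r * u⁻¹, s * u⁻¹, rfl⟩,
      (diagTorus_conj_scalarGenerator t u r s).symm⟩
  obtain ⟨s', hs', h'⟩ := h hs
  exact ⟨s', hs', h'.symm⟩

/-- The extension of the group generated by the matrices `M_θ(r, s)` by the split torus. -/
def torusExtension (t : K) : Subgroup (GL (Fin 2) F) where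
  carrier := {m | ∃ s ∈ scalarGroup t, ∃ u : kˣ, m = slToGL K s * diagTorus k F u}
  one_mem' := ⟨1, one_mem _, 1, by simp⟩
  mul_mem' := by
    rintro _ _ ⟨s, hs, u, rfl⟩ ⟨s', hs', u', rfl⟩
    obtain ⟨s'', hs'', h⟩ := diagTorus_conj_mem t u hs'
    refine ⟨s * s'', mul_mem hs hs'', u * u', ?_⟩
    rw [map_mul, map_mul, ← h]
    group
  inv_mem' := by
    rintro _ ⟨s, hs, u, rfl⟩
    obtain ⟨s'', hs'', h⟩ := diagTorus_conj_mem t u⁻¹ (inv_mem hs)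
    refine ⟨s'', hs'', u⁻¹, ?_⟩
    rw [← h, map_inv, map_inv]
    group

instance [Finite k] [Finite K] (t : K) : Finite (torusExtension t) := by
  have : Function.Surjective (fun x : scalarGroup t × kˣ =>
      (⟨slToGL K x.1 * diagTorus k F x.2, x.1, x.1.2, x.2, rfl⟩ : torusExtension t)) := by
    rintro ⟨m, s, hs, u, rfl⟩
    exact ⟨(⟨s, hs⟩, u), rfl⟩
  have : Finite (SpecialLinearGroup (Fin 2) K) := Subtype.finite
  exact Finite.of_surjective _ ‹_›

lemma diagTorus_mem (t : K) (u : kˣ) : diagTorus k F u ∈ torusExtension t :=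
  ⟨1, one_mem _, u, by simp⟩

lemma det_slToGL_mul_diagTorus {m : GL (Fin 2) F} {s : SpecialLinearGroup (Fin 2) K} {u : kˣ}
    (h : m = slToGL K s * diagTorus k F u) :
    m 0 0 * m 1 1 - m 0 1 * m 1 0 = algebraMap k F u := by
  have h1 : ((s 0 0 : K) : F) * (s 1 1 : K) - ((s 0 1 : K) : F) * (s 1 0 : K) = 1 := by
    have := s.det_coe
    rw [det_fin_two] at this
    exact_mod_cast this
  subst h
  simp only [Matrix.GeneralLinearGroup.coe_mul, Matrix.mul_apply, Fin.sum_univ_two, slToGL_apply,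
    diagTorus_zero_zero, diagTorus_zero_one, diagTorus_one_zero, diagTorus_one_one]
  linear_combination (algebraMap k F u) * h1

lemma exists_of_mem_torusExtension {t : K} {m : GL (Fin 2) F} (hm : m ∈ torusExtension t)
    (hdet : m 0 0 * m 1 1 - m 0 1 * m 1 0 = 1) : ∃ s ∈ scalarGroup t, m = slToGL K s := by
  obtain ⟨s, hs, u, h⟩ := hm
  refine ⟨s, hs, ?_⟩
  have : u = 1 := by
    rw [det_slToGL_mul_diagTorus h, ← map_one (algebraMap k F)] at hdet
    exact Units.ext ((algebraMap k F).injective hdet)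
  rw [h, this, map_one, mul_one]

/-- The conjugate torus. -/
def conjTorus (t : K) : kˣ →* GL (Fin 2) F :=
  (MulAut.conj (slToGL K (halfGenerator t (1 : kˣ)))⁻¹).toMonoidHom.comp (diagTorus k F)

lemma conjTorus_apply (t : K) (u : kˣ) : conjTorus t u = (slToGL K (halfGenerator t (1 : kˣ)))⁻¹ *
    diagTorus k F u * slToGL K (halfGenerator t (1 : kˣ)) := by
  simp [conjTorus]

/-- Moving diag(u,1) past h(1) gives h(1)⁻¹ diag(u,1) h(1) = M_θ(1,u⁻¹) diag(u,1). -/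
lemma conjTorus_mem (t : K) (u : kˣ) : conjTorus t u ∈ torusExtension t := by
  refine ⟨scalarGenerator t 1 (1 * u⁻¹), Subgroup.subset_closure ⟨_, _, rfl⟩, u, ?_⟩
  rw [conjTorus_apply, mul_assoc, diagTorus_mul_halfGenerator, scalarGenerator_eq, map_mul,
    map_inv, mul_assoc]

/-- A matrix with nonzero lower left entry is a product upper-lower-upper of unipotents; otherwise
multiplication by `lowerUnipotent 1` makes that entry nonzero. -/
lemma eq_top_of_unipotents_mem {E : Type*} [Field E]
    (S : Subgroup (SpecialLinearGroup (Fin 2) E))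
    (hU : ∀ x, upperUnipotent x ∈ S) (hL : ∀ x, lowerUnipotent x ∈ S) : S = ⊤ := by
  have key : ∀ s : SpecialLinearGroup (Fin 2) E, s 1 0 ≠ 0 → s ∈ S := by
    intro s hs
    have hdet := s.det_coe
    rw [det_fin_two] at hdet
    have : s = upperUnipotent ((s 0 0 - 1) / s 1 0) * lowerUnipotent (s 1 0) *
        upperUnipotent ((s 1 1 - 1) / s 1 0) := by
      ext i j
      fin_cases i <;> fin_cases j <;>
        simp [Matrix.mul_apply, Fin.sum_univ_two, hs]
      · field_simp
        linear_combination -hdet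
      · field_simp
        ring
    rw [this]
    exact mul_mem (mul_mem (hU _) (hL _)) (hU _)
  rw [eq_top_iff]
  intro s _
  by_cases hs : s 1 0 = 0
  · have hdet := s.det_coe
    rw [det_fin_two, hs, mul_zero, sub_zero] at hdet
    have h1 : lowerUnipotent 1 * s ∈ S := by
      refine key _ ?_
      have : (lowerUnipotent 1 * s : SpecialLinearGroup (Fin 2) E) 1 0 = s 0 0 := by
        simp [Matrix.mul_apply, Fin.sum_univ_two, hs]
      rw [this]
      exact left_ne_zero_of_mul_eq_one hdet
    exact (S.mul_mem_cancel_left (hL 1)).1 h1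
  · exact key s hs

end TorusExtension

/-! ### Descent to the subfield and generation of SL₂. -/

section SubfieldCase

open Matrix

variable {F : Type*} [Field F]

/-- A matrix preserving the projective line over a subfield is proportional to a matrix over that
subfield. -/
lemma exists_scalar_of_preserves_subfieldLine [DecidableEq F] {A : Subfield F} {m : GL (Fin 2) F}
    (hm : ∀ w ∈ subfieldLine A, m • w ∈ subfieldLine A) :
    ∃ c : F, ∀ i j, ∃ a ∈ A, m i j = c * a := by
  have hdet := gl_det_ne_zero m
  have hinf := hm OnePoint.infty (Or.inl rfl)
  have h0 := hm ((0 : F) : OnePoint F) (Or.inr ⟨0, A.zero_mem, rfl⟩)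
  have h1 := hm ((1 : F) : OnePoint F) (Or.inr ⟨1, A.one_mem, rfl⟩)
  have hsome : ∀ x : F, (x : OnePoint F) ∈ subfieldLine A → x ∈ A := by
    intro x hx
    simpa [subfieldLine] using hx
  rw [OnePoint.smul_infty_eq_ite] at hinf
  rw [OnePoint.smul_some_eq_ite, mul_zero, zero_add, mul_zero, zero_add] at h0
  rw [OnePoint.smul_some_eq_ite, mul_one, mul_one] at h1
  have fill : ∀ c : F, (∃ a ∈ A, m 0 0 = c * a) → (∃ a ∈ A, m 0 1 = c * a) →
      (∃ a ∈ A, m 1 0 = c * a) → (∃ a ∈ A, m 1 1 = c * a) → ∀ i j, ∃ a ∈ A, m i j = c * a := by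
    intro c h1 h2 h3 h4 i j
    fin_cases i <;> fin_cases j <;> assumption
  generalize m 0 0 = a at *
  generalize m 0 1 = b at *
  generalize m 1 0 = c at *
  generalize m 1 1 = d at *
  by_cases hc : c = 0
  · subst hc
    have hd : d ≠ 0 := by rintro rfl; simp at hdet
    rw [if_neg hd] at h0
    rw [if_neg (by simpa using hd)] at h1
    have hb' := hsome _ h0
    have ha' := hsome _ h1
    rw [zero_add] at ha'
    refine ⟨d, fill d ⟨a / d, ?_, by field_simp⟩ ⟨b / d, hb', by field_simp⟩
      ⟨0, A.zero_mem, by simp⟩ ⟨1, A.one_mem, by simp⟩⟩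
    have := A.sub_mem ha' hb'
    rwa [← sub_div, add_sub_cancel_right] at this
  · rw [if_neg hc] at hinf
    have ha := hsome _ hinf
    suffices h : b / c ∈ A ∧ d / c ∈ A from
      ⟨c, fill c ⟨a / c, ha, by field_simp⟩ ⟨b / c, h.1, by field_simp⟩
        ⟨1, A.one_mem, by simp⟩ ⟨d / c, h.2, by field_simp⟩⟩
    by_cases hd : d = 0
    · subst hd
      rw [if_neg (by simpa using hc)] at h1
      have := A.sub_mem (hsome _ h1) ha
      rw [add_zero, ← sub_div, add_sub_cancel_left] at this
      exact ⟨this, by simp⟩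
    · rw [if_neg hd] at h0
      have hb := hsome _ h0
      suffices h : d / c ∈ A by
        refine ⟨?_, h⟩
        have := A.mul_mem hb h
        rwa [div_mul_div_cancel₀ hd] at this
      by_cases hcd : c + d = 0
      · rw [eq_neg_of_add_eq_zero_right hcd, neg_div, div_self hc]
        exact A.neg_mem A.one_mem
      · rw [if_neg hcd] at h1
        have hs := hsome _ h1
        have hne : (a + b) / (c + d) - b / d ≠ 0 := by
          intro h
          apply hdet
          rw [sub_eq_zero, div_eq_div_iff hcd hd] at h
          linear_combination h
        -- With s = (a + b)/(c + d), the image of 1, this solves s(c + d) = a + b for d/c in terms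
        -- of the images of ∞, 0 and 1.
        have : d / c = (a / c - (a + b) / (c + d)) / ((a + b) / (c + d) - b / d) := by
          rw [eq_div_iff hne]
          field_simp
          ring
        rw [this]
        exact A.div_mem (A.sub_mem ha hs) (A.sub_mem hs hb)

/-- A matrix preserving the projective line over a subfield has entries in that subfield if its
trace is a nonzero element of it. -/
lemma mem_of_preserves_subfieldLine [DecidableEq F] {A : Subfield F} {m : GL (Fin 2) F}
    (hm : ∀ w ∈ subfieldLine A, m • w ∈ subfieldLine A) (htr : m 0 0 + m 1 1 ∈ A)
    (htr0 : m 0 0 + m 1 1 ≠ 0) (i j : Fin 2) : m i j ∈ A := by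
  obtain ⟨c, hc⟩ := exists_scalar_of_preserves_subfieldLine hm
  obtain ⟨a, ha, h0⟩ := hc 0 0
  obtain ⟨b, hb, h1⟩ := hc 1 1
  rw [h0, h1, ← mul_add] at htr htr0
  have hab := right_ne_zero_of_mul htr0
  have hcA : c ∈ A := by
    have := A.div_mem htr (A.add_mem ha hb)
    rwa [mul_div_cancel_right₀ _ hab] at this
  obtain ⟨x, hx, h⟩ := hc i j
  rw [h]
  exact A.mul_mem hcA hx

lemma upper_pow {m : GL (Fin 2) F} {b : F} (h10 : m 1 0 = 0) (h00 : m 0 0 = m 1 1)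
    (h01 : m 0 1 = b * m 1 1) (n : ℕ) : (m ^ n) 1 0 = 0 ∧ (m ^ n) 0 0 = m 1 1 ^ n ∧
      (m ^ n) 1 1 = m 1 1 ^ n ∧ (m ^ n) 0 1 = n * b * m 1 1 ^ n := by
  induction n with
  | zero => simp
  | succ n ih =>
    obtain ⟨i1, i2, i3, i4⟩ := ih
    simp only [pow_succ m, Matrix.GeneralLinearGroup.coe_mul, Matrix.mul_apply, Fin.sum_univ_two,
      i1, i2, i3, i4, h10, h00, h01]
    push_cast
    refine ⟨?_, ?_, ?_, ?_⟩ <;> ring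

lemma lower_pow {m : GL (Fin 2) F} {b : F} (h01 : m 0 1 = 0) (h00 : m 0 0 = m 1 1)
    (h10 : m 1 0 = b * m 1 1) (n : ℕ) : (m ^ n) 0 1 = 0 ∧ (m ^ n) 0 0 = m 1 1 ^ n ∧
      (m ^ n) 1 1 = m 1 1 ^ n ∧ (m ^ n) 1 0 = n * b * m 1 1 ^ n := by
  induction n with
  | zero => simp
  | succ n ih =>
    obtain ⟨i1, i2, i3, i4⟩ := ih
    simp only [pow_succ m, Matrix.GeneralLinearGroup.coe_mul, Matrix.mul_apply, Fin.sum_univ_two,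
      i1, i2, i3, i4, h10, h00, h01]
    push_cast
    refine ⟨?_, ?_, ?_, ?_⟩ <;> ring

lemma conj_trace (g m : GL (Fin 2) F) :
    (g * m * g⁻¹) 0 0 + (g * m * g⁻¹) 1 1 = m 0 0 + m 1 1 := by
  rw [← Matrix.trace_fin_two, ← Matrix.trace_fin_two]
  simp only [Matrix.GeneralLinearGroup.coe_mul]
  rw [Matrix.trace_mul_cycle, Units.inv_mul, one_mul]

lemma conj_det (g m : GL (Fin 2) F) :
    (g * m * g⁻¹) 0 0 * (g * m * g⁻¹) 1 1 - (g * m * g⁻¹) 0 1 * (g * m * g⁻¹) 1 0 =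
      m 0 0 * m 1 1 - m 0 1 * m 1 0 := by
  rw [← Matrix.det_fin_two, ← Matrix.det_fin_two]
  simp only [Matrix.GeneralLinearGroup.coe_mul]
  rw [Matrix.det_mul_right_comm, Units.mul_inv, one_mul]

variable {p : ℕ} [Fact p.Prime] [Algebra (ZMod p) F] {K : IntermediateField (ZMod p) F}

/-- Preserving the line gives entries in A only up to a scalar, which a nonzero trace in A removes.
The choice u = 2 gives trace 3 ≠ 0 in both tori, and the product of the two elements has trace 5 +
θ. -/
lemma mem_subfield_of_preserves [DecidableEq F] (hp : 5 ≤ p) (t : K) {g : GL (Fin 2) F}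
    {A : Subfield F}
    (hA : ∀ m ∈ torusExtension t, ∀ w ∈ subfieldLine A, (g * m * g⁻¹) • w ∈ subfieldLine A) :
    (t : F) ∈ A := by
  have : CharP F p := charP_of_injective_algebraMap (algebraMap (ZMod p) F).injective p
  have hn : ∀ n : ℕ, 0 < n → n < p → (n : ZMod p) ≠ 0 := by
    intro n h0 hlt h
    have := Nat.le_of_dvd h0 ((ZMod.natCast_eq_zero_iff n p).1 h)
    omega
  have h3 : (3 : F) ≠ 0 := by
    have := (map_ne_zero (algebraMap (ZMod p) F)).2 (hn 3 (by norm_num) (by omega))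
    rw [map_natCast] at this
    exact_mod_cast this
  let u : (ZMod p)ˣ := Units.mk0 ((2 : ℕ) : ZMod p) (hn 2 (by norm_num) (by omega))
  have hu : algebraMap (ZMod p) F u = 2 :=
    (map_natCast (algebraMap (ZMod p) F) 2).trans (by norm_num)
  have htr1 : diagTorus (ZMod p) F u 0 0 + diagTorus (ZMod p) F u 1 1 = 3 := by
    rw [diagTorus_zero_zero, diagTorus_one_one, hu]; norm_num
  have htr2 : conjTorus t u 0 0 + conjTorus t u 1 1 = 3 := by
    have := conj_trace (slToGL K (halfGenerator t (1 : (ZMod p)ˣ)))⁻¹ (diagTorus (ZMod p) F u)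
    rw [inv_inv] at this
    rw [conjTorus_apply, this, htr1]
  have hA3 : (3 : F) ∈ A := by exact_mod_cast natCast_mem A 3
  have hx := mem_of_preserves_subfieldLine (hA _ (diagTorus_mem t u))
    (by rw [conj_trace, htr1]; exact hA3) (by rw [conj_trace, htr1]; exact h3)
  have hy := mem_of_preserves_subfieldLine (hA _ (conjTorus_mem t u))
    (by rw [conj_trace, htr2]; exact hA3) (by rw [conj_trace, htr2]; exact h3)
  have htr := conj_trace g (conjTorus t u * diagTorus (ZMod p) F u)
  have hmul : g * (conjTorus t u * diagTorus (ZMod p) F u) * g⁻¹ =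
      (g * conjTorus t u * g⁻¹) * (g * diagTorus (ZMod p) F u * g⁻¹) := by group
  have hval : (conjTorus t u * diagTorus (ZMod p) F u) 0 0 +
      (conjTorus t u * diagTorus (ZMod p) F u) 1 1 = 5 + t := by
    have h1 : slToGL K (halfGenerator t (1 : (ZMod p)ˣ)) * conjTorus t u =
        diagTorus (ZMod p) F u * slToGL K (halfGenerator t (1 : (ZMod p)ˣ)) := by
      rw [conjTorus_apply]; group
    have e : ∀ i j, (slToGL K (halfGenerator t (1 : (ZMod p)ˣ)) * conjTorus t u) i j =
        (diagTorus (ZMod p) F u * slToGL K (halfGenerator t (1 : (ZMod p)ˣ))) i j := by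
      rw [h1]; simp
    have e00 := e 0 0
    have e01 := e 0 1
    have e10 := e 1 0
    have e11 := e 1 1
    simp only [Matrix.GeneralLinearGroup.coe_mul, Matrix.mul_apply, Fin.sum_univ_two,
      slToGL_apply, halfGenerator_coe, diagTorus_zero_zero, diagTorus_zero_one,
      diagTorus_one_zero, diagTorus_one_one, hu] at e00 e01 e10 e11 ⊢
    simp at e00 e01 e10 e11
    linear_combination 2 * (e00 - e10) + ((1 + t) * e11 - t * e01)
  rw [hmul, hval] at htr
  have hmem : (5 : F) + t ∈ A := by
    rw [← htr]
    simp only [Matrix.GeneralLinearGroup.coe_mul, Matrix.mul_apply, Fin.sum_univ_two] at hx hy ⊢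
    exact A.add_mem (A.add_mem (A.mul_mem (hy _ _) (hx _ _)) (A.mul_mem (hy _ _) (hx _ _)))
      (A.add_mem (A.mul_mem (hy _ _) (hx _ _)) (A.mul_mem (hy _ _) (hx _ _)))
  have h5 : (5 : F) ∈ A := by exact_mod_cast natCast_mem A 5
  simpa using A.sub_mem hmem h5

theorem scalarGroup_eq_top_of_subfield (hp : 5 ≤ p) [Finite K] (t : K) {g : GL (Fin 2) F}
    {A : Subfield F} (hK : ∀ x : K, (x : F) ∈ A)
    (hU : ∀ a ∈ A, ∃ m ∈ torusExtension t, (g * m * g⁻¹) 1 0 = 0 ∧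
      (g * m * g⁻¹) 0 0 = (g * m * g⁻¹) 1 1 ∧ (g * m * g⁻¹) 0 1 = a * (g * m * g⁻¹) 1 1)
    (hL : ∀ a ∈ A, ∃ m ∈ torusExtension t, (g * m * g⁻¹) 0 1 = 0 ∧
      (g * m * g⁻¹) 0 0 = (g * m * g⁻¹) 1 1 ∧ (g * m * g⁻¹) 1 0 = a * (g * m * g⁻¹) 1 1) :
    scalarGroup t = ⊤ := by
  have : CharP F p := charP_of_injective_algebraMap (algebraMap (ZMod p) F).injective p
  -- The scalar c of a scaled unipotent in Γ satisfies c² = det ∈ F_p^*, so cⁿ = 1. As n is prime to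
  -- p, dividing the off-diagonal entry by n beforehand makes the n-th power the desired unipotent.
  set n := 2 * (p - 1) with hn
  have hnF : (n : F) ≠ 0 := by
    intro h
    have h1 := (CharP.cast_eq_zero_iff F p n).1 h
    have hprime : p.Prime := Fact.out
    rcases hprime.dvd_mul.1 h1 with h2 | h2
    · have := Nat.le_of_dvd (by norm_num) h2; omega
    · have := Nat.le_of_dvd (by omega) h2; omega
  have hscal : ∀ m ∈ torusExtension t,
      ((g * m * g⁻¹) 0 1 = 0 ∨ (g * m * g⁻¹) 1 0 = 0) →
      (g * m * g⁻¹) 0 0 = (g * m * g⁻¹) 1 1 → (g * m * g⁻¹) 1 1 ^ n = 1 := by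
    intro m hm h0 h1
    obtain ⟨s, hs, u, h⟩ := hm
    have h2 := det_slToGL_mul_diagTorus h
    rw [← conj_det g m, h1, (by rcases h0 with h | h <;> simp [h] :
      (g * m * g⁻¹) 0 1 * (g * m * g⁻¹) 1 0 = 0), sub_zero, ← pow_two] at h2
    rw [hn, pow_mul, h2, ← map_pow, ← Units.val_pow_eq_pow_val, ZMod.units_pow_card_sub_one_eq_one]
    simp
  have hAn : ∀ a ∈ A, a / n ∈ A := fun a ha => A.div_mem ha (natCast_mem A n)
  let S : Subgroup (SpecialLinearGroup (Fin 2) K) :=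
    ((torusExtension t).map (MulAut.conj g).toMonoidHom).comap (slToGL K)
  have hS : S = ⊤ := by
    refine eq_top_of_unipotents_mem S (fun x => ?_) (fun x => ?_)
    · obtain ⟨m, hm, h1, h2, h3⟩ := hU _ (hAn _ (hK x))
      obtain ⟨j1, j2, j3, j4⟩ := upper_pow h1 h2 h3 n
      rw [hscal m hm (Or.inr h1) h2] at j2 j3 j4
      refine ⟨m ^ n, Subgroup.pow_mem _ hm n, ?_⟩
      change g * m ^ n * g⁻¹ = _
      rw [← conj_pow]
      generalize (g * m * g⁻¹) ^ n = b at *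
      ext i j
      fin_cases i <;> fin_cases j <;> simp [j1, j2, j3, j4]
      field_simp
    · obtain ⟨m, hm, h1, h2, h3⟩ := hL _ (hAn _ (hK x))
      obtain ⟨j1, j2, j3, j4⟩ := lower_pow h1 h2 h3 n
      rw [hscal m hm (Or.inl h1) h2] at j2 j3 j4
      refine ⟨m ^ n, Subgroup.pow_mem _ hm n, ?_⟩
      change g * m ^ n * g⁻¹ = _
      rw [← conj_pow]
      generalize (g * m * g⁻¹) ^ n = b at *
      ext i j
      fin_cases i <;> fin_cases j <;> simp [j1, j2, j3, j4]
      field_simp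
  -- The conjugating matrix g need not be defined over K, so this yields only an injection of SL₂(K)
  -- into the group; finiteness does the rest.
  have hf : ∀ s : SpecialLinearGroup (Fin 2) K, ∃ s' : scalarGroup t,
      g * slToGL K s' * g⁻¹ = slToGL K s := by
    intro s
    have hs : s ∈ S := hS ▸ Subgroup.mem_top s
    obtain ⟨m, hm, h⟩ := hs
    change g * m * g⁻¹ = _ at h
    obtain ⟨s', hs', rfl⟩ := exists_of_mem_torusExtension hm (by
      rw [← conj_det g m, h]
      have := s.det_coe
      rw [det_fin_two] at this
      simp only [slToGL_apply]
      exact_mod_cast this)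
    exact ⟨⟨s', hs'⟩, h⟩
  choose f hf using hf
  have hinj : Function.Injective f := by
    intro a b hab
    apply slToGL_injective
    rw [← hf a, ← hf b, hab]
  have : Finite (SpecialLinearGroup (Fin 2) K) := Subtype.finite
  exact Subgroup.eq_top_of_le_card _ (Nat.card_le_card_of_injective f hinj)

end SubfieldCase

/-! ### Excluding groups without parabolic elements. -/

section NonParabolicCase

open Matrix

variable {k F : Type*} [Field k] [Field F] [Algebra k F] [DecidableEq F] {K : IntermediateField k F}

local notation "X" => OnePoint F
local notation "∞'" => (OnePoint.infty : OnePoint F)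

lemma one_add_coe_ne_zero {k F : Type*} [Field k] [Field F] [Algebra k F] {K : IntermediateField k F}
    {t : K} (ht : t ≠ -1) : 1 + (t : F) ≠ 0 := by
  intro h
  apply ht
  have : ((1 + t : K) : F) = 0 := by simpa using h
  rw [ZeroMemClass.coe_eq_zero] at this
  exact eq_neg_of_add_eq_zero_right this

lemma diagTorus_smul_infty (u : kˣ) : diagTorus k F u • ∞' = ∞' := by
  simp [OnePoint.smul_infty_eq_ite]

lemma diagTorus_smul_coe (u : kˣ) (x : F) :
    diagTorus k F u • (x : X) = ((algebraMap k F u * x : F) : X) := by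
  simp [OnePoint.smul_some_eq_ite]

lemma diagTorus_smul_eq_self {u : kˣ} {x : X} (h : diagTorus k F u • x = x) :
    u = 1 ∨ x = ∞' ∨ x = ((0 : F) : X) := by
  cases x with
  | infty => exact Or.inr (Or.inl rfl)
  | coe x =>
    rw [diagTorus_smul_coe, OnePoint.coe_eq_coe] at h
    rcases eq_or_ne x 0 with rfl | hx
    · exact Or.inr (Or.inr rfl)
    · left
      have := mul_right_cancel₀ hx (h.trans (one_mul x).symm)
      rw [← map_one (algebraMap k F)] at this
      exact Units.ext ((algebraMap k F).injective this)

lemma conjTorus_smul_eq_self {t : K} {u : kˣ} {x : X} (h : conjTorus t u • x = x) :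
    u = 1 ∨ x = (slToGL K (halfGenerator t (1 : kˣ)))⁻¹ • ∞' ∨
      x = (slToGL K (halfGenerator t (1 : kˣ)))⁻¹ • ((0 : F) : X) := by
  rw [conjTorus_apply, mul_smul, mul_smul, inv_smul_eq_iff] at h
  refine (diagTorus_smul_eq_self h).imp id (Or.imp ?_ ?_) <;> exact fun h => eq_inv_smul_iff.2 h

lemma conjTorus_smul_first (t : K) (u : kˣ) :
    conjTorus t u • (slToGL K (halfGenerator t (1 : kˣ)))⁻¹ • ∞' =
      (slToGL K (halfGenerator t (1 : kˣ)))⁻¹ • ∞' := by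
  rw [conjTorus_apply, mul_smul, mul_smul, smul_inv_smul, diagTorus_smul_infty]

lemma conjTorus_smul_second (t : K) (u : kˣ) :
    conjTorus t u • (slToGL K (halfGenerator t (1 : kˣ)))⁻¹ • ((0 : F) : X) =
      (slToGL K (halfGenerator t (1 : kˣ)))⁻¹ • ((0 : F) : X) := by
  rw [conjTorus_apply, mul_smul, mul_smul, smul_inv_smul, diagTorus_smul_coe, mul_zero]

lemma halfGenerator_inv_smul_infty {t : K} (ht : t ≠ 0) :
    (slToGL K (halfGenerator t (1 : kˣ)))⁻¹ • ∞' = ((-(t : F)⁻¹ : F) : X) := by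
  have ht' : (t : F) ≠ 0 := by simpa using ht
  rw [inv_smul_eq_iff, OnePoint.smul_some_eq_ite, if_pos]
  simp [halfGenerator_coe, ht']

lemma halfGenerator_inv_smul_zero {t : K} (ht : t ≠ -1) :
    (slToGL K (halfGenerator t (1 : kˣ)))⁻¹ • ((0 : F) : X) = ((-(1 + t : F)⁻¹ : F) : X) := by
  have ht' : 1 + (t : F) ≠ 0 := one_add_coe_ne_zero ht
  have hne : (t : F) * (-(1 + t : F)⁻¹) + 1 ≠ 0 := by
    have : (t : F) * (-(1 + t : F)⁻¹) + 1 = (1 + t : F)⁻¹ := by field_simp; ring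
    rw [this]
    exact inv_ne_zero ht'
  rw [inv_smul_eq_iff, OnePoint.smul_some_eq_ite, if_neg]
  · simp [halfGenerator_coe, ht']
  · simpa [halfGenerator_coe] using hne

/-- A torus in a matrix group, as a subgroup of the stabilizer of a fixed point in the group of
Möbius transformations. -/
def torusToStabilizer {Γ : Subgroup (GL (Fin 2) F)} (T : kˣ →* GL (Fin 2) F) (hT : ∀ u, T u ∈ Γ)
    (x : X) (hx : ∀ u, T u • x = x) : kˣ →* stabilizer (moebiusGroup Γ) x where
  toFun u := ⟨toMoebius (T u) (hT u), hx u⟩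
  map_one' := Subtype.ext (moebius_ext fun w => by
    change T 1 • w = w
    rw [map_one, one_smul])
  map_mul' u v := Subtype.ext (moebius_ext fun w => by
    change T (u * v) • w = T u • T v • w
    rw [map_mul, mul_smul])

omit [Algebra k F] in
lemma torusToStabilizer_injective {Γ : Subgroup (GL (Fin 2) F)} (T : kˣ →* GL (Fin 2) F)
    (hT : ∀ u, T u ∈ Γ) (x : X) (hx : ∀ u, T u • x = x) (y : X) (hy : ∀ u, T u • y = y → u = 1) :
    Function.Injective (torusToStabilizer T hT x hx) := by
  rw [injective_iff_map_eq_one]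
  intro u hu
  refine hy u ?_
  have : toMoebius (T u) (hT u) = 1 := congrArg Subtype.val hu
  rw [← toMoebius_smul (T u) (hT u), this, one_smul]

omit [Algebra k F] in
lemma torus_smul_injective (T : kˣ →* GL (Fin 2) F) (y : X) (hy : ∀ u, T u • y = y → u = 1) :
    Function.Injective fun u => T u • y := by
  intro u v huv
  have : T (v⁻¹ * u) • y = y := by
    rw [map_mul, mul_smul, map_inv, inv_smul_eq_iff]; exact huv
  exact (inv_mul_eq_one.1 (hy _ this)).symm

/-- Among the groups in question, only the octahedral group in characteristic `5` has no parabolic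
elements. -/
theorem exists_parabolic_torusExtension {p : ℕ} [Fact p.Prime] (hp : 5 ≤ p) [Algebra (ZMod p) F]
    [IsAlgClosed F] {K : IntermediateField (ZMod p) F} [Finite K] {t : K} (ht0 : t ≠ 0)
    (ht1 : t ≠ -1) (hexc : ¬ (p = 5 ∧ t = 2)) :
    ∃ P : X, 1 < parabolicCount (moebiusGroup (torusExtension (F := F) t)) P := by
  by_contra! hno
  have : CharP F p := charP_of_injective_algebraMap (algebraMap (ZMod p) F).injective p
  set Γ := torusExtension (F := F) t
  have hM := isMoebiusLike_moebiusGroup p Γ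
  have hfinH : Finite (moebiusGroup Γ) :=
    Finite.of_surjective _ (MonoidHom.subgroupMap_surjective _ Γ)
  have hq : ∀ P : X, parabolicCount (moebiusGroup Γ) P = 1 := fun P =>
    le_antisymm (hno P) (parabolicCount_pos P)
  have hcardU : Nat.card (ZMod p)ˣ = p - 1 := by
    rw [Nat.card_eq_fintype_card, ZMod.card_units]
  have ht0' : (t : F) ≠ 0 := by simpa using ht0
  have ht1' : 1 + (t : F) ≠ 0 := one_add_coe_ne_zero ht1
  have hw1eq := halfGenerator_inv_smul_infty (k := ZMod p) (F := F) ht0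
  have hw2eq := halfGenerator_inv_smul_zero (k := ZMod p) (F := F) ht1
  have hfix1 := fun u : (ZMod p)ˣ => conjTorus_smul_first (F := F) t u
  have hfix2 := fun u : (ZMod p)ˣ => conjTorus_smul_second (F := F) t u
  have hfix := fun (u : (ZMod p)ˣ) (x : X) => conjTorus_smul_eq_self (F := F) (t := t) (u := u) (x := x)
  set w1 := (slToGL K (halfGenerator t (1 : (ZMod p)ˣ)))⁻¹ • ∞'
  set w2 := (slToGL K (halfGenerator t (1 : (ZMod p)ˣ)))⁻¹ • ((0 : F) : X)
  have hw1i : w1 ≠ ∞' := hw1eq ▸ OnePoint.coe_ne_infty _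
  have hw2i : w2 ≠ ∞' := hw2eq ▸ OnePoint.coe_ne_infty _
  have hw10 : w1 ≠ ((0 : F) : X) := by
    rw [hw1eq, Ne, OnePoint.coe_eq_coe]; simpa using ht0'
  have hw20 : w2 ≠ ((0 : F) : X) := by
    rw [hw2eq, Ne, OnePoint.coe_eq_coe]; simpa using ht1'
  have hw12 : w1 ≠ w2 := by
    rw [hw1eq, hw2eq, Ne, OnePoint.coe_eq_coe, neg_inj, _root_.inv_inj]
    simp
  have hDw1 : ∀ u, diagTorus (ZMod p) F u • w1 = w1 → u = 1 := fun u h =>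
    (diagTorus_smul_eq_self h).resolve_right (not_or.2 ⟨hw1i, hw10⟩)
  have hCinf : ∀ u, conjTorus t u • ∞' = ∞' → u = 1 := fun u h =>
    (hfix u _ h).resolve_right (not_or.2 ⟨hw1i.symm, hw2i.symm⟩)
  have hdvd : ∀ x : X, (∀ u, diagTorus (ZMod p) F u • x = x) →
      p - 1 ∣ Nat.card (stabilizer (moebiusGroup Γ) x) := fun x hx => by
    rw [← hcardU]
    exact Subgroup.card_dvd_of_injective _
      (torusToStabilizer_injective _ (diagTorus_mem t) x hx w1 hDw1)
  have hdvd' : ∀ x : X, (∀ u : (ZMod p)ˣ, conjTorus t u • x = x) →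
      p - 1 ∣ Nat.card (stabilizer (moebiusGroup Γ) x) := fun x hx => by
    rw [← hcardU]
    exact Subgroup.card_dvd_of_injective _
      (torusToStabilizer_injective _ (conjTorus_mem t) x hx ∞' hCinf)
  have h4 : ∀ x : X, p - 1 ∣ Nat.card (stabilizer (moebiusGroup Γ) x) →
      4 ≤ Nat.card (stabilizer (moebiusGroup Γ) x) := fun x hx => by
    have := Nat.le_of_dvd Nat.card_pos hx
    omega
  have hdinf := hdvd ∞' diagTorus_smul_infty
  have hOfin : (orbit (moebiusGroup Γ) ∞').Finite := Set.finite_range _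
  have hn : 3 ≤ Nat.card (orbit (moebiusGroup Γ) ∞') := by
    have h1 : Set.range (fun u : (ZMod p)ˣ => conjTorus t u • ∞') ⊆ orbit (moebiusGroup Γ) ∞' := by
      rintro _ ⟨u, rfl⟩
      exact ⟨toMoebius (conjTorus t u) (conjTorus_mem t u), rfl⟩
    have h2 := Set.ncard_le_ncard h1 hOfin
    rw [Set.ncard_range_of_injective (torus_smul_injective _ _ hCinf), hcardU] at h2
    have h3 : (orbit (moebiusGroup Γ) ∞').ncard = Nat.card (orbit (moebiusGroup Γ) ∞') := rfl
    omega
  obtain ⟨he5, hn6, hmem⟩ := hM.orbit_of_four_le_card_stabilizer hq (h4 _ hdinf) hn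
  -- The stabilizer order is at most 5 and divisible by p - 1 ≥ 4, and p = 6 is not prime.
  obtain rfl : p = 5 := by
    have hprime : p.Prime := Fact.out
    have := Nat.le_of_dvd Nat.card_pos hdinf
    have hne : p ≠ 6 := fun h => absurd (h ▸ hprime) (by norm_num)
    omega
  have he4 : Nat.card (stabilizer (moebiusGroup Γ) ∞') = 4 := by
    have := h4 _ hdinf
    omega
  have hn6 := hn6 he4
  have h0O := hmem _ (h4 _ (hdvd ((0 : F) : X) fun u => by rw [diagTorus_smul_coe, mul_zero]))
  have hw1O := hmem w1 (h4 _ (hdvd' w1 hfix1))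
  have hw2O := hmem w2 (h4 _ (hdvd' w2 hfix2))
  set R := Set.range (fun u : (ZMod 5)ˣ => diagTorus (ZMod 5) F u • w1) with hR
  have hRi : ∞' ∉ R := by
    rintro ⟨u, hu⟩
    exact hw1i (MulAction.injective (diagTorus (ZMod 5) F u) (hu.trans (diagTorus_smul_infty u).symm))
  have hR0 : ((0 : F) : X) ∉ R := by
    rintro ⟨u, hu⟩
    refine hw10 (MulAction.injective (diagTorus (ZMod 5) F u) (hu.trans ?_))
    change _ = diagTorus (ZMod 5) F u • _
    rw [diagTorus_smul_coe, mul_zero]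
  have hRcard : R.ncard = 4 := by
    rw [hR, Set.ncard_range_of_injective (torus_smul_injective _ _ hDw1), hcardU]
  have hsub : insert ∞' (insert ((0 : F) : X) R) ⊆ orbit (moebiusGroup Γ) ∞' := by
    refine Set.insert_subset (mem_orbit_self _) (Set.insert_subset h0O ?_)
    rintro _ ⟨u, rfl⟩
    have : toMoebius (diagTorus (ZMod 5) F u) (diagTorus_mem t u) • w1 ∈
        orbit (moebiusGroup Γ) ∞' := by
      rw [← orbit_eq_iff, orbit_smul, orbit_eq_iff]; exact hw1O
    exact this
  -- The orbit has six points, so it consists of ∞, 0 and the four images of w1 under D; in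
  -- particular w2 is one of these images.
  have hRfin : R.Finite := Set.finite_range _
  have hO := Set.eq_of_subset_of_ncard_le hsub (by
    rw [Set.ncard_insert_of_notMem (by
      rw [Set.mem_insert_iff, not_or]; exact ⟨OnePoint.infty_ne_coe _, hRi⟩) (hRfin.insert _),
      Set.ncard_insert_of_notMem hR0 hRfin, hRcard]
    exact hn6.le) hOfin
  rw [← hO] at hw2O
  obtain ⟨u, hu⟩ : w2 ∈ R := by
    rcases hw2O with h | h | h
    · exact absurd h hw2i
    · exact absurd h hw20
    · exact h
  change diagTorus (ZMod 5) F u • w1 = w2 at hu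
  have hw2card : Nat.card (stabilizer (moebiusGroup Γ) w2) = 4 := by
    have : w2 ∈ orbit (moebiusGroup Γ) ∞' := hO ▸ hw2O
    obtain ⟨h, hh⟩ := this
    rw [← hh, ← he4]
    exact card_stabilizer_smul h ∞'
  have hsurj : Function.Surjective
      (torusToStabilizer (Γ := Γ) (conjTorus t) (conjTorus_mem t) w2 hfix2) :=
    ((Nat.bijective_iff_injective_and_card _).2
      ⟨torusToStabilizer_injective _ (conjTorus_mem t) w2 hfix2 ∞' hCinf,
        by rw [hcardU, hw2card]⟩).2
  have hu2 : u ≠ 1 := by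
    rintro rfl
    rw [map_one, one_smul] at hu
    exact hw12 hu
  -- By cardinality C induces the whole stabilizer of w2, and C also fixes w1.
  have hstab : ∀ m ∈ Γ, m • w2 = w2 → m • w1 = w1 := by
    intro m hm hmw
    obtain ⟨v, hv⟩ := hsurj ⟨toMoebius m hm, hmw⟩
    have : toMoebius (conjTorus t v) (conjTorus_mem t v) = toMoebius m hm := congrArg Subtype.val hv
    rw [← toMoebius_smul m hm, ← this]
    exact hfix1 v
  -- As diag(u,1) carries w1 to w2, conjugating C by it fixes w2, hence w1. So diag(u,1)⁻¹ w1 is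
  -- fixed by C and is w1 or w2; either way u² = 1.
  have hconj := hstab (diagTorus (ZMod 5) F u * conjTorus t u * (diagTorus (ZMod 5) F u)⁻¹)
    (mul_mem (mul_mem (diagTorus_mem t u) (conjTorus_mem t u)) (inv_mem (diagTorus_mem t u)))
    (by rw [← hu, mul_smul, mul_smul, inv_smul_smul, hfix1])
  rw [mul_smul, mul_smul, ← eq_inv_smul_iff] at hconj
  have husq : u * u = 1 := by
    refine hDw1 _ ?_
    rcases (hfix _ _ hconj).resolve_left hu2 with h | h
    · rw [inv_smul_eq_iff] at h
      rw [map_mul, mul_smul, ← h, ← h]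
    · rw [inv_smul_eq_iff, ← hu, ← mul_smul, ← map_mul] at h
      exact h.symm
  have hum : (u : ZMod 5) = -1 := by
    have h1 : (u : ZMod 5) * u = 1 := by
      rw [← Units.val_mul, husq, Units.val_one]
    rcases mul_self_eq_one_iff.1 h1 with h | h
    · exact absurd (Units.ext h) hu2
    · exact h
  -- Now u = -1 gives 1/θ = -1/(1 + θ), that is 2θ = -1, so θ = 2 in characteristic 5.
  rw [hw1eq, hw2eq, diagTorus_smul_coe, OnePoint.coe_eq_coe, hum, map_neg, map_one] at hu
  have h5 : (5 : F) = 0 := by exact_mod_cast CharP.cast_eq_zero F 5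
  refine hexc ⟨rfl, ?_⟩
  have h6 : (t : F) = 2 := by
    have h7 : (t : F) = -(1 + t) := by
      have h8 : (t : F)⁻¹ = (-(1 + t : F))⁻¹ := by
        rw [inv_neg, ← hu]; ring
      exact inv_injective h8
    linear_combination 3 * h7 - (t + 1 : F) * h5
  exact Subtype.ext (by rw [h6]; rfl)

/-- The two tori have no common fixed point. -/
lemma two_le_card_orbit {p : ℕ} [Fact p.Prime] (hp : 5 ≤ p) [Algebra (ZMod p) F]
    {K : IntermediateField (ZMod p) F} [Finite K] {t : K} (ht0 : t ≠ 0) (ht1 : t ≠ -1) (P : X) :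
    2 ≤ Nat.card (orbit (moebiusGroup (torusExtension (F := F) t)) P) := by
  set Γ := torusExtension (F := F) t
  have hfinH : Finite (moebiusGroup Γ) :=
    Finite.of_surjective _ (MonoidHom.subgroupMap_surjective _ Γ)
  have hfin : Finite (orbit (moebiusGroup Γ) P) := Set.finite_range _
  by_contra! hlt
  have hsub : Subsingleton (orbit (moebiusGroup Γ) P) :=
    Finite.card_le_one_iff_subsingleton.1 (by omega)
  have hfixP : ∀ m ∈ Γ, m • P = P := fun m hm =>
    congrArg Subtype.val (hsub.elim ⟨toMoebius m hm • P, mem_orbit _ _⟩ ⟨P, mem_orbit_self P⟩)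
  have : Nontrivial (ZMod p)ˣ := Fintype.one_lt_card_iff_nontrivial.1 (by
    rw [ZMod.card_units]; omega)
  obtain ⟨u, hu⟩ := exists_ne (1 : (ZMod p)ˣ)
  have h1 := (diagTorus_smul_eq_self (hfixP _ (diagTorus_mem t u))).resolve_left hu
  have h2 := (conjTorus_smul_eq_self (hfixP _ (conjTorus_mem t u))).resolve_left hu
  rw [halfGenerator_inv_smul_infty ht0, halfGenerator_inv_smul_zero ht1] at h2
  have ht0' : (t : F) ≠ 0 := by simpa using ht0
  have ht1' : 1 + (t : F) ≠ 0 := one_add_coe_ne_zero ht1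
  rcases h1 with rfl | rfl
  · simp at h2
  · simp only [OnePoint.coe_eq_coe] at h2
    rcases h2 with h | h
    · exact neg_ne_zero.2 (inv_ne_zero ht0') h.symm
    · exact neg_ne_zero.2 (inv_ne_zero ht1') h.symm

end NonParabolicCase

/-! ### The generation theorem. -/

theorem lemma10p5 (p : ℕ) [Fact p.Prime] (hp : 5 ≤ p)
    (θ : AlgebraicClosure (ZMod p)) (hθ0 : θ ≠ 0) (hθ1 : θ ≠ -1)
    (hexc : ¬ (p = 5 ∧ θ = 2)) :
    Subgroup.closure
      {g : Matrix.SpecialLinearGroup (Fin 2) (IntermediateField.adjoin (ZMod p) {θ}) |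
        ∃ r s : (ZMod p)ˣ,
          g = scalarGenerator (IntermediateField.AdjoinSimple.gen (ZMod p) θ) r s} = ⊤ := by
  classical
  set t := IntermediateField.AdjoinSimple.gen (ZMod p) θ with ht
  have htθ : (t : AlgebraicClosure (ZMod p)) = θ := IntermediateField.AdjoinSimple.coe_gen _ _
  have : FiniteDimensional (ZMod p) (IntermediateField.adjoin (ZMod p) {θ}) :=
    IntermediateField.adjoin.finiteDimensional (Algebra.IsIntegral.isIntegral θ)
  have : Finite (IntermediateField.adjoin (ZMod p) {θ}) := Module.finite_of_finite (ZMod p)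
  have ht0 : t ≠ 0 := fun h => hθ0 (by rw [← htθ, h]; rfl)
  have ht1 : t ≠ -1 := fun h => hθ1 (by rw [← htθ, h]; rfl)
  have hexc' : ¬ (p = 5 ∧ t = 2) := fun h => hexc ⟨h.1, by rw [← htθ, h.2]; rfl⟩
  obtain ⟨P, hP⟩ := exists_parabolic_torusExtension hp ht0 ht1 hexc'
  have : CharP (AlgebraicClosure (ZMod p)) p :=
    charP_of_injective_algebraMap (algebraMap (ZMod p) (AlgebraicClosure (ZMod p))).injective p
  have hn := two_le_card_orbit hp ht0 ht1 P
  obtain ⟨g, A, hA, hU, hL⟩ := exists_subfield_of_parabolic p hp (torusExtension t) hP hn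
  have htA := mem_subfield_of_preserves hp t hA
  refine scalarGroup_eq_top_of_subfield hp t (fun x => ?_) hU hL
  obtain ⟨x, hx⟩ := x
  rw [htθ] at htA
  induction hx using IntermediateField.adjoin_induction with
  | mem x hx => exact (Set.mem_singleton_iff.1 hx : x = θ) ▸ htA
  | algebraMap x =>
    obtain ⟨n, rfl⟩ := ZMod.natCast_zmod_surjective x
    have h := natCast_mem A n
    rwa [← map_natCast (algebraMap (ZMod p) (AlgebraicClosure (ZMod p))) n] at h
  | add x y _ _ hx hy => exact A.add_mem hx hy
  | inv x _ hx => exact A.inv_mem hx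
  | mul x y _ _ hx hy => exact A.mul_mem hx hy
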